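/- Let $\mathcal H=L^2(\mathbb R)$ be the one-mode Hilbert space of wavefunctions in the $X$-representation, with the displacement $(D(x)\psi)(t)=\psi(t-x)$, the squeezing $(S(r)\psi)(t)=e^{-r/2}\psi(e^{-r}t)$ and the parity operator $(P\psi)(t)=\psi(-t)$. Let $Y=-\frac i2\frac{d}{dt}$ be the conjugate quadrature; functions $f(Y)$ are multiplication by $f(y)$, on the maximal domain, in the representation $\langle y|\psi\rangle=\pi^{-1/2}\int e^{-2ity}\psi(t)\,dt$. Let $G$ be the group of the maps $t\mapsto(-1)^\epsilon(e^rt+x)$ of the line, $\epsilon\in\{0,1\}$, $x,r\in\mathbb R$, with the measure $d_Lg$ that is the counting measure in $\epsilon$ times $e^{-r}\,dx\,dr$, and put $U_g=P^\epsilon D(x)S(r)$ for $g=(\epsilon,x,r)$. 1. $d_Lg$ is a left Haar measure on $G$, and $g\mapsto U_g$ is a strongly continuous unitary representation of $G$ that is irreducible on $\mathcal H$. 2. The Duflo–Moore–Carey (DMC) operator of $U$ exists, is unique, and equals $D=\pi/|Y|$. Here a positive self-adjoint operator $D$ is called a DMC operator of $U$ if: a vector $\psi$ satisfies $\int|\langle\psi|U_g\psi\rangle|^2d_Lg<\infty$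 if and only if $\psi\in\mathrm{dom}(D^{1/2})$; for all $\psi,\psi'\in\mathrm{dom}(D^{1/2})$ and all $\varphi,\chi\in\mathcal H$, the following integral converges absolutely and $\int\langle\varphi|U_g\psi\rangle\langle U_g\psi'|\chi\rangle\,d_Lg=\langle D^{1/2}\psi'|D^{1/2}\psi\rangle\,\langle\varphi|\chi\rangle$; and for every bounded operator $A\ge0$ the group average $\langle A\rangle_G=\int U_gAU_g^\dagger\,d_Lg$ converges in the weak operator sense if and only if $\mathrm{Tr}[DA]:=\mathrm{Tr}[A^{1/2}DA^{1/2}]=\sum_i\|D^{1/2}A^{1/2}e_i\|^2<\infty$ ($(e_i)$ any orthonormal basis; a term is $\infty$ if $A^{1/2}e_i\notin\mathrm{dom}(D^{1/2})$), and then $\langle A\rangle_G=\mathrm{Tr}[DA]\,\mathbb 1$. 3. A covariant POVM is $M(g)=U_g\xi U_g^\dagger$ with a bounded seed $\xi\ge0$ such that $\int M(g)\,d_Lg=\mathbb 1$ weakly; its probability density for a unit input vector $\psi$ is $p(\hat g|g)=\langle U_g\psi|M(\hat g)|U_g\psi\rangle$, and its likelihood is $p(g|g)$. If $\psi\in\mathrm{dom}(|Y|^{1/2})$,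 the supremum of the likelihood over all covariant POVMs is $\frac1\pi\||Y|^{1/2}\psi\|^2$. If $\psi\in\mathrm{dom}(|Y|)$, then $\langle\psi||Y||\psi\rangle>0$ and the covariant POVM with seed $\xi=|\eta\rangle\langle\eta|$, $$\eta=\frac{|Y|\psi}{\sqrt{\pi\,\langle\psi||Y||\psi\rangle}},$$ is a maximum-likelihood one: it is normalized as above and its likelihood is the largest among all covariant POVMs, with value $\frac1\pi\langle\psi||Y||\psi\rangle$. -/

import Mathlib

open MeasureTheory
open scoped ENNReal InnerProductSpace

noncomputable section

/-! ### Estimation with a unitary representation of a group -/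

section General

variable {H : Type} [NormedAddCommGroup H] [InnerProductSpace ℂ H] [CompleteSpace H]
variable {G : Type} [Group G] [MeasurableSpace G]

/-- `U` is a strongly continuous unitary representation of `G` on `H`. -/
structure IsUnitaryRep [TopologicalSpace G] (U : G → H ≃ₗᵢ[ℂ] H) : Prop where
  map_mul : ∀ g h : G, U (g * h) = U g * U h
  strongly_continuous : ∀ v : H, Continuous fun g => U g v

/-- The only closed invariant subspaces are the two trivial ones, which are distinct. -/
def IsIrreducibleRep (U : G → H ≃ₗᵢ[ℂ] H) : Prop :=
  Nontrivial H ∧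
    ∀ K : Submodule ℂ H, IsClosed (K : Set H) → (∀ g, ∀ v ∈ K, U g v ∈ K) → K = ⊥ ∨ K = ⊤

/-- The operator `U_g A U_g†`. -/
def conjOp (U : G → H ≃ₗᵢ[ℂ] H) (A : H →L[ℂ] H) (g : G) : H →L[ℂ] H :=
  ((U g).toContinuousLinearEquiv : H →L[ℂ] H) ∘L A ∘L
    ((U g).symm.toContinuousLinearEquiv : H →L[ℂ] H)

/-- The matrix element `⟨φ| ⟨A⟩_G |χ⟩` of the group average `⟨A⟩_G = ∫ dg U_g A U_g†`,
taken in the weak operator sense. -/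
def groupAverage (μ : Measure G) (U : G → H ≃ₗᵢ[ℂ] H) (A : H →L[ℂ] H) (φ χ : H) : ℂ :=
  ∫ g, ⟪φ, conjOp U A g χ⟫_ℂ ∂μ

/-- `A` is admissible: its group average converges in the weak operator sense. -/
def IsAdmissibleOp (μ : Measure G) (U : G → H ≃ₗᵢ[ℂ] H) (A : H →L[ℂ] H) : Prop :=
  ∀ φ χ : H, Integrable (fun g => ⟪φ, conjOp U A g χ⟫_ℂ) μ

/-- `ψ` is an admissible vector: `∫ dg |⟨ψ| U_g |ψ⟩|² < ∞`. -/
def IsAdmissibleVec (μ : Measure G) (U : G → H ≃ₗᵢ[ℂ] H) (ψ : H) : Prop :=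
  Integrable (fun g => ‖⟪ψ, U g ψ⟫_ℂ‖ ^ 2) μ

/-- Self-adjoint and positive unbounded operators. -/
def IsPositiveSelfAdjoint (T : H →ₗ.[ℂ] H) : Prop :=
  IsSelfAdjoint T ∧ ∀ v : T.domain, 0 ≤ (⟪(v : H), T v⟫_ℂ).re

/-- `R` is the positive self-adjoint square root of the unbounded operator `D`. -/
def IsSqrtOf (R D : H →ₗ.[ℂ] H) : Prop :=
  IsPositiveSelfAdjoint R ∧
    ∀ v w : H, (v, w) ∈ D.graph ↔ ∃ u : H, (v, u) ∈ R.graph ∧ (u, w) ∈ R.graph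

open Classical in
/-- `‖R v‖²`, with the value `∞` if `v` is not in the domain of `R`. -/
def sqNormOrTop (R : H →ₗ.[ℂ] H) (v : H) : ℝ≥0∞ :=
  if h : v ∈ R.domain then ENNReal.ofReal (‖R ⟨v, h⟩‖ ^ 2) else ⊤

/-- The trace `Tr[D A] = Tr[A^{1/2} D A^{1/2}] ∈ [0, ∞]` of a positive bounded operator `A` against
the positive self-adjoint operator `D` with square root `R`, computed in the orthonormal
basis `b`. -/
def traceAgainst {ι : Type} (R : H →ₗ.[ℂ] H) (A : H →L[ℂ] H) (b : HilbertBasis ι ℂ H) : ℝ≥0∞ :=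
  ∑' i, sqNormOrTop R (CFC.sqrt A (b i))

/-- `D` is the Duflo-Moore-Carey operator of `U` with respect to the left Haar measure `μ`:
a positive self-adjoint operator such that
* the admissible vectors are the domain of `D^{1/2}`;
* `∫ dg ⟨φ|U_g|ψ⟩⟨ψ'|U_g†|χ⟩ = ⟨D^{1/2}ψ'|D^{1/2}ψ⟩ ⟨φ|χ⟩` for admissible `ψ`, `ψ'`;
* a positive operator `A` is admissible exactly if `Tr[D A] < ∞`, and then
  `⟨A⟩_G = Tr[D A] 1`. -/
def IsDMCOperator (μ : Measure G) (U : G → H ≃ₗᵢ[ℂ] H) (D : H →ₗ.[ℂ] H) : Prop :=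
  IsPositiveSelfAdjoint D ∧ ∃ R : H →ₗ.[ℂ] H, IsSqrtOf R D ∧
    (∀ ψ : H, IsAdmissibleVec μ U ψ ↔ ψ ∈ R.domain) ∧
    (∀ (ψ ψ' : R.domain) (φ χ : H),
      Integrable (fun g => ⟪φ, U g ψ⟫_ℂ * ⟪U g ψ', χ⟫_ℂ) μ ∧
        ∫ g, ⟪φ, U g ψ⟫_ℂ * ⟪U g ψ', χ⟫_ℂ ∂μ = ⟪R ψ', R ψ⟫_ℂ * ⟪φ, χ⟫_ℂ) ∧
    (∀ A : H →L[ℂ] H, A.IsPositive → ∀ (ι : Type) (b : HilbertBasis ι ℂ H),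
      (IsAdmissibleOp μ U A ↔ traceAgainst R A b < ⊤) ∧
        (IsAdmissibleOp μ U A → ∀ φ χ : H,
          groupAverage μ U A φ χ = ((traceAgainst R A b).toReal : ℂ) * ⟪φ, χ⟫_ℂ))

/-- `ξ` is the seed of a covariant POVM `M(g) = U_g ξ U_g†`: it is a positive operator with
`∫ dg U_g ξ U_g† = 1`. -/
def IsCovariantSeed (μ : Measure G) (U : G → H ≃ₗᵢ[ℂ] H) (ξ : H →L[ℂ] H) : Prop :=
  ξ.IsPositive ∧ IsAdmissibleOp μ U ξ ∧ ∀ φ χ : H, groupAverage μ U ξ φ χ = ⟪φ, χ⟫_ℂ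

/-- The probability density `p(g'|g) = ⟨ψ| U_g† M(g') U_g |ψ⟩` of the estimate `g'` when the true
value is `g`, for the input state `ψ` and the POVM `M(g') = U_{g'} ξ U_{g'}†`. -/
def probDensity (U : G → H ≃ₗᵢ[ℂ] H) (ξ : H →L[ℂ] H) (ψ : H) (g' g : G) : ℝ :=
  (⟪U g ψ, conjOp U ξ g' (U g ψ)⟫_ℂ).re

/-- The covariant POVM with seed `ξ` is a maximum-likelihood one for the input state `ψ`: it
maximizes the likelihood `p(g|g)` over all covariant POVMs. -/
def IsMaxLikelihoodSeed (μ : Measure G) (U : G → H ≃ₗᵢ[ℂ] H) (ψ : H) (ξ : H →L[ℂ] H) : Prop :=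
  IsCovariantSeed μ U ξ ∧
    ∀ ξ', IsCovariantSeed μ U ξ' → ∀ g, probDensity U ξ' ψ g g ≤ probDensity U ξ ψ g g

end General

/-! ### The one-mode space and the quadrature `Y` -/

/-- The one-mode space, as the space of wavefunctions in the `X`-representation. -/
abbrev OneMode : Type := Lp ℂ 2 (volume : Measure ℝ)

theorem eLpNorm_affine (c b : ℝ) (hc : c ≠ 0) (f : ℝ → ℂ) (hf : AEStronglyMeasurable f volume) :
    AEStronglyMeasurable (fun x => ((Real.sqrt |c|)⁻¹ : ℂ) * f (c⁻¹ * (x - b))) volume ∧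
    eLpNorm (fun x => ((Real.sqrt |c|)⁻¹ : ℂ) * f (c⁻¹ * (x - b))) 2 volume
      = eLpNorm f 2 volume := by
  have hmap : Measure.map (fun x : ℝ => c⁻¹ * (x - b)) volume
      = ENNReal.ofReal |c| • (volume : Measure ℝ) := by
    have h1 : (fun x : ℝ => c⁻¹ * (x - b)) = (fun x => c⁻¹ * x) ∘ (fun x => x - b) := rfl
    rw [h1, ← Measure.map_map (by fun_prop) (by fun_prop),
      (measurePreserving_sub_right volume b).map_eq,
      Real.map_volume_mul_left (inv_ne_zero hc), inv_inv]
  have hpos : 0 < |c| := abs_pos.mpr hc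
  have hT : Measurable (fun x : ℝ => c⁻¹ * (x - b)) := by fun_prop
  have hfm : AEStronglyMeasurable f (Measure.map (fun x : ℝ => c⁻¹ * (x - b)) volume) := by
    rw [hmap]
    exact hf.mono_ac Measure.smul_absolutelyContinuous
  have hcomp := hfm.comp_measurable hT
  refine ⟨hcomp.const_mul _, ?_⟩
  have h2 : (fun x => ((Real.sqrt |c|)⁻¹ : ℂ) * f (c⁻¹ * (x - b)))
      = ((Real.sqrt |c|)⁻¹ : ℂ) • (f ∘ fun x : ℝ => c⁻¹ * (x - b)) := rfl
  rw [h2, eLpNorm_const_smul, ← eLpNorm_map_measure hfm hT.aemeasurable, hmap,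
    eLpNorm_smul_measure_of_ne_top (by norm_num), smul_eq_mul, ← mul_assoc]
  have h3 : ‖((Real.sqrt |c|)⁻¹ : ℂ)‖ₑ * ENNReal.ofReal |c| ^ (1 / (2 : ℝ≥0∞)).toReal = 1 := by
    have h4 : ‖((Real.sqrt |c|)⁻¹ : ℂ)‖ₑ = ENNReal.ofReal ((Real.sqrt |c|)⁻¹) := by
      rw [← ofReal_norm, norm_inv, Complex.norm_real, Real.norm_of_nonneg (by positivity)]
    have h5 : (1 / (2 : ℝ≥0∞)).toReal = 1 / 2 := by simp
    rw [h4, h5, ENNReal.ofReal_rpow_of_pos hpos, ← Real.sqrt_eq_rpow,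
      ← ENNReal.ofReal_mul (by positivity), inv_mul_cancel₀ (by positivity), ENNReal.ofReal_one]
  rw [h3, one_mul]

theorem memLp_affine (c b : ℝ) (hc : c ≠ 0) (f : OneMode) :
    MemLp (fun x => ((Real.sqrt |c|)⁻¹ : ℂ) * f (c⁻¹ * (x - b))) 2 volume :=
  ⟨(eLpNorm_affine c b hc f (Lp.aestronglyMeasurable f)).1, by
    rw [(eLpNorm_affine c b hc f (Lp.aestronglyMeasurable f)).2]; exact Lp.eLpNorm_lt_top f⟩

theorem quasi_affine (c b : ℝ) (hc : c ≠ 0) :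
    Measure.QuasiMeasurePreserving (fun x : ℝ => c⁻¹ * (x - b)) volume volume := by
  refine ⟨by fun_prop, ?_⟩
  have h1 : (fun x : ℝ => c⁻¹ * (x - b)) = (fun x => c⁻¹ * x) ∘ (fun x => x - b) := rfl
  rw [h1, ← Measure.map_map (by fun_prop) (by fun_prop),
      (measurePreserving_sub_right volume b).map_eq,
      Real.map_volume_mul_left (inv_ne_zero hc)]
  exact Measure.smul_absolutelyContinuous

def affineLinear (c b : ℝ) (hc : c ≠ 0) : OneMode →ₗ[ℂ] OneMode where
  toFun f := (memLp_affine c b hc f).toLp _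
  map_add' f g := by
    apply Lp.ext
    filter_upwards [(memLp_affine c b hc (f + g)).coeFn_toLp, (memLp_affine c b hc f).coeFn_toLp,
      (memLp_affine c b hc g).coeFn_toLp,
      Lp.coeFn_add ((memLp_affine c b hc f).toLp _) ((memLp_affine c b hc g).toLp _),
      (quasi_affine c b hc).ae_eq_comp (Lp.coeFn_add f g)] with x h1 h2 h3 h4 h5
    simp only [Function.comp_apply, Pi.add_apply] at h5
    rw [h1, h4, Pi.add_apply, h2, h3, h5, mul_add]
  map_smul' a f := by
    apply Lp.ext
    filter_upwards [(memLp_affine c b hc (a • f)).coeFn_toLp, (memLp_affine c b hc f).coeFn_toLp,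
      Lp.coeFn_smul a ((memLp_affine c b hc f).toLp _),
      (quasi_affine c b hc).ae_eq_comp (Lp.coeFn_smul a f)] with x h1 h2 h4 h5
    simp only [Function.comp_apply, Pi.smul_apply, smul_eq_mul] at h5
    rw [h1, RingHom.id_apply, h4, Pi.smul_apply, h2, h5, smul_eq_mul]
    ring

def affineIsometry (c b : ℝ) (hc : c ≠ 0) : OneMode →ₗᵢ[ℂ] OneMode where
  toLinearMap := affineLinear c b hc
  norm_map' f := by
    change ‖(memLp_affine c b hc f).toLp _‖ = ‖f‖
    rw [Lp.norm_toLp, (eLpNorm_affine c b hc f (Lp.aestronglyMeasurable f)).2, Lp.norm_def]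

theorem affineIsometry_surjective (c b : ℝ) (hc : c ≠ 0) :
    Function.Surjective (affineIsometry c b hc) := by
  intro f
  have hc' := inv_ne_zero hc
  refine ⟨affineIsometry c⁻¹ (-(c⁻¹ * b)) hc' f, ?_⟩
  change (memLp_affine c b hc ((memLp_affine c⁻¹ (-(c⁻¹ * b)) hc' f).toLp _)).toLp _ = f
  apply Lp.ext
  filter_upwards [(memLp_affine c b hc ((memLp_affine c⁻¹ (-(c⁻¹ * b)) hc' f).toLp _)).coeFn_toLp,
    (quasi_affine c b hc).ae_eq_comp (memLp_affine c⁻¹ (-(c⁻¹ * b)) hc' f).coeFn_toLp]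
    with x h1 h2
  simp only [Function.comp_apply] at h2
  rw [h1, h2, inv_inv, ← mul_assoc]
  have h3 : c * (c⁻¹ * (x - b) - -(c⁻¹ * b)) = x := by field_simp; ring
  have h4 : ((Real.sqrt |c|)⁻¹ : ℂ) * ((Real.sqrt |c⁻¹|)⁻¹ : ℂ) = 1 := by
    have hpos : 0 < |c| := abs_pos.mpr hc
    rw [abs_inv, Real.sqrt_inv]
    have : (Real.sqrt |c| : ℂ) ≠ 0 := by
      exact_mod_cast (Real.sqrt_pos.mpr hpos).ne'
    push_cast
    field_simp
  rw [h3, h4, one_mul]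

/-- The unitary operator `ψ(x) ↦ |c|^{-1/2} ψ(c⁻¹ (x - b))`. -/
def affineUnitary (c b : ℝ) (hc : c ≠ 0) : OneMode ≃ₗᵢ[ℂ] OneMode :=
  LinearIsometryEquiv.ofSurjective (affineIsometry c b hc) (affineIsometry_surjective c b hc)

theorem affineUnitary_ae (c b : ℝ) (hc : c ≠ 0) (ψ : OneMode) :
    affineUnitary c b hc ψ =ᵐ[volume]
      fun x => ((Real.sqrt |c|)⁻¹ : ℂ) * ψ (c⁻¹ * (x - b)) :=
  (memLp_affine c b hc ψ).coeFn_toLp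

/-- Displacement, `(D(x₀) ψ)(x) = ψ(x - x₀)`. -/
def displacementOp (x₀ : ℝ) : OneMode ≃ₗᵢ[ℂ] OneMode := affineUnitary 1 x₀ one_ne_zero

/-- Squeezing, `(S(r) ψ)(x) = e^{-r/2} ψ(e^{-r} x)`. -/
def squeezeOp (r : ℝ) : OneMode ≃ₗᵢ[ℂ] OneMode := affineUnitary (Real.exp r) 0 (Real.exp_ne_zero r)

/-- Parity, `(P ψ)(x) = ψ(-x)`. -/
def parityOp : OneMode ≃ₗᵢ[ℂ] OneMode := affineUnitary (-1) 0 (by norm_num)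

/-- The passage `ψ ↦ ⟨y|ψ⟩` to the representation of the quadrature `Y = -(i/2) d/dx`, whose
Dirac-normalized eigenfunctions are `⟨x|y⟩ = π^{-1/2} e^{2ixy}`:
`⟨y|ψ⟩ = π^{-1/2} ∫ e^{-2ixy} ψ(x) dx = π^{-1/2} (ℱ ψ)(y/π)`, where
`(ℱ ψ)(k) = ∫ e^{-2πixk} ψ(x) dx`. -/
def yRep : OneMode ≃ₗᵢ[ℂ] OneMode :=
  (Lp.fourierTransformₗᵢ ℝ ℂ).trans (affineUnitary Real.pi 0 Real.pi_ne_zero)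

/-- The functions `φ ∈ L²(ℝ)` with `f φ ∈ L²(ℝ)`. -/
def mulDomain (f : ℝ → ℝ) : Submodule ℂ OneMode where
  carrier := {φ | MemLp (fun y => (f y : ℂ) * φ y) 2 volume}
  zero_mem' := by
    have h : (fun y => (f y : ℂ) * (0 : OneMode) y) =ᵐ[volume] fun _ => (0 : ℂ) := by
      filter_upwards [Lp.coeFn_zero ℂ 2 (volume : Measure ℝ)] with y hy
      rw [hy, Pi.zero_apply, mul_zero]
    exact (memLp_congr_ae h).mpr MemLp.zero
  add_mem' := by
    intro a b ha hb
    refine (memLp_congr_ae ?_).mpr (MemLp.add ha hb)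
    filter_upwards [Lp.coeFn_add a b] with y hy
    rw [hy, Pi.add_apply, Pi.add_apply, mul_add]
  smul_mem' := by
    intro c a ha
    refine (memLp_congr_ae ?_).mpr (MemLp.const_smul ha c)
    filter_upwards [Lp.coeFn_smul c a] with y hy
    rw [hy, Pi.smul_apply, Pi.smul_apply, smul_eq_mul, smul_eq_mul]
    ring

theorem mem_mulDomain {f : ℝ → ℝ} {φ : OneMode} :
    φ ∈ mulDomain f ↔ MemLp (fun y => (f y : ℂ) * φ y) 2 volume := Iff.rfl

/-- Multiplication by `f` on its maximal domain. -/
def mulMap (f : ℝ → ℝ) : mulDomain f →ₗ[ℂ] OneMode where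
  toFun φ := MemLp.toLp (fun y => (f y : ℂ) * (φ : OneMode) y) (mem_mulDomain.mp φ.2)
  map_add' a b := by
    rw [← MemLp.toLp_add]
    apply MemLp.toLp_congr
    filter_upwards [Lp.coeFn_add (a : OneMode) (b : OneMode)] with y hy
    rw [Submodule.coe_add, hy, Pi.add_apply, Pi.add_apply, mul_add]
  map_smul' c a := by
    rw [RingHom.id_apply, ← MemLp.toLp_const_smul]
    apply MemLp.toLp_congr
    filter_upwards [Lp.coeFn_smul c (a : OneMode)] with y hy
    rw [Submodule.coe_smul, hy, Pi.smul_apply, Pi.smul_apply, smul_eq_mul, smul_eq_mul]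
    ring

/-- The unbounded operator `f(Y)`, multiplication by `f(y)` in the `Y`-representation, on its
maximal domain `{ψ | ∫ |f(y)⟨y|ψ⟩|² dy < ∞}`. -/
def funY (f : ℝ → ℝ) : OneMode →ₗ.[ℂ] OneMode where
  domain := (mulDomain f).comap (yRep.toLinearEquiv : OneMode →ₗ[ℂ] OneMode)
  toFun := (yRep.symm.toLinearEquiv : OneMode →ₗ[ℂ] OneMode) ∘ₗ mulMap f ∘ₗ
    (yRep.toLinearEquiv : OneMode →ₗ[ℂ] OneMode).restrict (fun _ h => h)

theorem mem_funY_domain {f : ℝ → ℝ} {ψ : OneMode} :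
    ψ ∈ (funY f).domain ↔ MemLp (fun y => (f y : ℂ) * yRep ψ y) 2 volume := Iff.rfl

theorem yRep_funY_ae {f : ℝ → ℝ} (ψ : (funY f).domain) :
    yRep (funY f ψ) =ᵐ[volume] fun y => (f y : ℂ) * yRep (ψ : OneMode) y := by
  have h : yRep (funY f ψ) = MemLp.toLp _ (mem_funY_domain.mp ψ.2) :=
    yRep.apply_symm_apply _
  rw [h]
  exact MemLp.coeFn_toLp _

/-- `|Y|` -/
def absY : OneMode →ₗ.[ℂ] OneMode := funY fun y => |y|

/-- `|Y|^{1/2}` -/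
def sqrtAbsY : OneMode →ₗ.[ℂ] OneMode := funY fun y => Real.sqrt |y|

/-- `π / |Y|` -/
def piDivAbsY : OneMode →ₗ.[ℂ] OneMode := funY fun y => Real.pi / |y|

/-! ### The affine group of the line with reflections -/

/-- The group of the maps `t ↦ (-1)^ε (e^r t + x)` of the real line. -/
@[ext]
structure ReflAffine where
  eps : ZMod 2
  x : ℝ
  r : ℝ

namespace ReflAffine

/-- The sign `(-1)^ε`. -/
def sgn (e : ZMod 2) : ℝ := (-1) ^ e.val

theorem sgn_zero : sgn 0 = 1 := by simp [sgn]

theorem sgn_add (a b : ZMod 2) : sgn (a + b) = sgn a * sgn b := by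
  have h : ∀ a b : ZMod 2, (a + b).val = (a.val + b.val) % 2 := by decide
  rw [sgn, sgn, sgn, h, ← pow_add]
  exact (neg_one_pow_eq_pow_mod_two _).symm

theorem sgn_mul_self (a : ZMod 2) : sgn a * sgn a = 1 := by
  rw [sgn, ← pow_add, ← two_mul, pow_mul]; norm_num

/-- Composition of maps of the line. -/
instance : Mul ReflAffine :=
  ⟨fun g h => ⟨g.eps + h.eps, sgn h.eps * g.x + Real.exp g.r * h.x, g.r + h.r⟩⟩

instance : One ReflAffine := ⟨⟨0, 0, 0⟩⟩

instance : Inv ReflAffine :=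
  ⟨fun g => ⟨-g.eps, -(sgn g.eps * Real.exp (-g.r) * g.x), -g.r⟩⟩

theorem mul_def (g h : ReflAffine) :
    g * h = ⟨g.eps + h.eps, sgn h.eps * g.x + Real.exp g.r * h.x, g.r + h.r⟩ := rfl

theorem one_def : (1 : ReflAffine) = ⟨0, 0, 0⟩ := rfl

theorem inv_def (g : ReflAffine) :
    g⁻¹ = ⟨-g.eps, -(sgn g.eps * Real.exp (-g.r) * g.x), -g.r⟩ := rfl

instance : Group ReflAffine :=
  Group.ofLeftAxioms
    (fun a b c => by
      simp only [mul_def, sgn_add, Real.exp_add]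
      ext
      · exact add_assoc _ _ _
      · dsimp only; ring
      · exact add_assoc _ _ _)
    (fun a => by simp [mul_def, one_def])
    (fun a => by
      simp only [mul_def, one_def, inv_def]
      ext
      · exact neg_add_cancel _
      · dsimp only
        linear_combination (-(Real.exp (-a.r) * a.x)) * sgn_mul_self a.eps
      · exact neg_add_cancel _)

/-- The action of a group element on the line. -/
def act (g : ReflAffine) (t : ℝ) : ℝ := sgn g.eps * (Real.exp g.r * t + g.x)

theorem act_mul (g h : ReflAffine) (t : ℝ) : (g * h).act t = g.act (h.act t) := by
  simp only [act, mul_def, sgn_add, Real.exp_add]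
  linear_combination (sgn g.eps * g.x) * sgn_mul_self h.eps

/-- The coordinates `(ε, x, r)`. -/
def coords (g : ReflAffine) : ZMod 2 × ℝ × ℝ := (g.eps, g.x, g.r)

instance : TopologicalSpace ReflAffine := TopologicalSpace.induced coords inferInstance

instance : MeasurableSpace ReflAffine := MeasurableSpace.comap coords inferInstance

/-- The left-invariant measure: counting measure in `ε` times `e^{-r} dx dr`. -/
def leftHaar : Measure ReflAffine :=
  Measure.map (fun p : ZMod 2 × ℝ × ℝ => (⟨p.1, p.2.1, p.2.2⟩ : ReflAffine))
    ((Measure.count : Measure (ZMod 2)).prod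
      ((volume : Measure ℝ).prod
        ((volume : Measure ℝ).withDensity fun r => ENNReal.ofReal (Real.exp (-r)))))

end ReflAffine

/-- The unitary operators `P^ε D(x) S(r)`. -/
def reflAffineRep (g : ReflAffine) : OneMode ≃ₗᵢ[ℂ] OneMode :=
  parityOp ^ g.eps.val * displacementOp g.x * squeezeOp g.r

/-- The vector `|Y| ψ / √(π ⟨ψ| |Y| |ψ⟩)`. -/
def optimalVec (ψ : absY.domain) : OneMode :=
  ((Real.sqrt (Real.pi * (⟪(ψ : OneMode), absY ψ⟫_ℂ).re))⁻¹ : ℂ) • absY ψ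

end

/-! Everything follows from one identity in [0, ∞]: ∫ |⟨φ|U_g ψ⟩|² dg = ‖φ‖² ‖Rψ‖² with R =
√(π/|Y|), the value ∞ of ‖Rψ‖² meaning that ψ is outside dom R (`hasOrthogonality_reflAffineRep`).
In the Y-representation U_g dilates by c = ±e^r and multiplies by a phase linear in x. Up to the
factor √|c|, the matrix element as a function of x is therefore a Fourier transform of conj(φ(y))
ψ(cy). Plancherel in x gives π|c| ∫ |φ(y)|² |ψ(cy)|² dy, and |c| = e^r cancels the Haar density
e^{-r}. For every y ≠ 0, summing over the sign and integrating over r makes z = cy sweep the line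
with measure dz/|z|. The double integral thus factorizes, and the weight π/|z| left on |ψ(z)|² is
the symbol of D.

The rest is abstract (`HasOrthogonality`). Polarization in both pairs of vectors gives the
sesquilinear orthogonality relation; Tonelli over an orthonormal basis gives the trace formula for
group averages. Irreducibility holds because R is injective, and D is unique because its quadratic
form is determined.

For the likelihood, a normalized seed has Tr[Dξ] = 1. If ψ = Rζ, then ⟨ψ|ξψ⟩ = ∑ |⟨Rξ^{1/2}e_i|ζ⟩|²
≤ ‖ζ‖² Tr[Dξ] = ‖ζ‖² by Cauchy-Schwarz. Seeds |η⟩⟨η| with ‖Rη‖ = 1 have likelihood |⟨Rη|ζ⟩|², so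
density of the range of R makes ‖ζ‖² the supremum, and it is attained when Rη = ζ/‖ζ‖. Here ζ =
π^{-1/2}|Y|^{1/2}ψ, and η is then the multiple of |Y|ψ in `optimalVec`. -/

noncomputable section

set_option linter.unusedSectionVars false

/-! ### Parseval in [0, ∞], polarization and operator square roots -/

section Hilbert

variable {H : Type} [NormedAddCommGroup H] [InnerProductSpace ℂ H]

/-- Orthonormal vectors are √2 apart, so their balls of radius 1/2 are disjoint. Countability of a
basis is what later allows its sum to be exchanged with the Haar integral. -/
theorem Orthonormal.countable_of_separableSpace [TopologicalSpace.SeparableSpace H] {ι : Type}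
    {v : ι → H} (hv : Orthonormal ℂ v) : Countable ι := by
  refine Pairwise.countable_of_isOpen_disjoint (s := fun i => Metric.ball (v i) (1 / 2)) ?_
    (fun i => Metric.isOpen_ball) (fun i => ⟨v i, Metric.mem_ball_self (by norm_num)⟩)
  intro i j hij
  refine Metric.ball_disjoint_ball ?_
  have h : ‖v i - v j‖ ^ 2 = 2 := by
    rw [@norm_sub_sq ℂ, hv.1 i, hv.1 j, hv.2 hij]
    norm_num
  rw [dist_eq_norm]
  nlinarith [norm_nonneg (v i - v j)]

theorem HilbertBasis.hasSum_norm_inner_sq {ι : Type} (b : HilbertBasis ι ℂ H) (v : H) :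
    HasSum (fun i => ‖⟪b i, v⟫_ℂ‖ ^ 2) (‖v‖ ^ 2) := by
  have h := (b.hasSum_inner_mul_inner v v).mapL Complex.reCLM
  have h2 : (fun i => Complex.reCLM (⟪v, b i⟫_ℂ * ⟪b i, v⟫_ℂ)) = fun i => ‖⟪b i, v⟫_ℂ‖ ^ 2 := by
    ext i
    rw [← inner_conj_symm v (b i), mul_comm, Complex.mul_conj, Complex.normSq_eq_norm_sq]
    exact Complex.ofReal_re _
  rw [h2] at h
  convert h using 1
  rw [inner_self_eq_norm_sq_to_K]
  norm_cast

theorem HilbertBasis.tsum_enorm_inner_sq {ι : Type} (b : HilbertBasis ι ℂ H) (v : H) :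
    ∑' i, ‖⟪b i, v⟫_ℂ‖ₑ ^ 2 = ‖v‖ₑ ^ 2 := by
  have h := b.hasSum_norm_inner_sq v
  have h2 := ENNReal.ofReal_tsum_of_nonneg (fun i => sq_nonneg ‖⟪b i, v⟫_ℂ‖) h.summable
  rw [h.tsum_eq] at h2
  simpa only [← ofReal_norm, ENNReal.ofReal_pow (norm_nonneg _)] using h2.symm

theorem polarization_apply (T : H →ₗ[ℂ] H) (φ χ : H) :
    ⟪φ, T χ⟫_ℂ = (⟪φ + χ, T (φ + χ)⟫_ℂ - ⟪φ - χ, T (φ - χ)⟫_ℂ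
      - Complex.I * ⟪φ + Complex.I • χ, T (φ + Complex.I • χ)⟫_ℂ
      + Complex.I * ⟪φ - Complex.I • χ, T (φ - Complex.I • χ)⟫_ℂ) / 4 := by
  simp only [map_add, map_sub, map_smul, inner_add_left, inner_add_right, inner_sub_left,
    inner_sub_right, inner_smul_left, inner_smul_right, Complex.conj_I]
  linear_combination (⟪φ, T χ⟫_ℂ - ⟪χ, T φ⟫_ℂ) / 2 * Complex.I_sq

theorem integral_polarization {G : Type} [MeasurableSpace G] {μ : Measure G} {a b c d : G → ℂ}
    (ha : Integrable a μ) (hb : Integrable b μ) (hc : Integrable c μ) (hd : Integrable d μ) :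
    Integrable (fun g => (a g - b g - Complex.I * c g + Complex.I * d g) / 4) μ ∧
      ∫ g, (a g - b g - Complex.I * c g + Complex.I * d g) / 4 ∂μ
        = (∫ g, a g ∂μ - ∫ g, b g ∂μ - Complex.I * ∫ g, c g ∂μ + Complex.I * ∫ g, d g ∂μ) / 4 := by
  have i3 := hc.const_mul Complex.I
  have i4 := hd.const_mul Complex.I
  have h12 : Integrable (fun g => a g - b g) μ := ha.sub hb
  have h123 : Integrable (fun g => a g - b g - Complex.I * c g) μ := h12.sub i3
  refine ⟨(h123.add i4).div_const 4, ?_⟩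
  rw [integral_div, integral_add h123 i4, integral_sub h12 i3, integral_sub ha hb,
    integral_const_mul, integral_const_mul]

/-- A sesquilinear form is determined by its diagonal, so weak integrals need only be computed for φ
= χ, where the integrands are nonnegative and Tonelli applies. -/
theorem integral_inner_eq_of_diag {G : Type} [MeasurableSpace G] {μ : Measure G}
    {B : G → H →ₗ[ℂ] H} {t : ℂ}
    (hi : ∀ φ, Integrable (fun g => ⟪φ, B g φ⟫_ℂ) μ)
    (ht : ∀ φ, ∫ g, ⟪φ, B g φ⟫_ℂ ∂μ = t * ⟪φ, φ⟫_ℂ) (φ χ : H) :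
    Integrable (fun g => ⟪φ, B g χ⟫_ℂ) μ ∧ ∫ g, ⟪φ, B g χ⟫_ℂ ∂μ = t * ⟪φ, χ⟫_ℂ := by
  have e : (fun g => ⟪φ, B g χ⟫_ℂ) = _ := funext fun g => polarization_apply (B g) φ χ
  have e2 := polarization_apply LinearMap.id φ χ
  simp only [LinearMap.id_coe, id_eq] at e2
  obtain ⟨i, j⟩ := integral_polarization (hi (φ + χ)) (hi (φ - χ)) (hi (φ + Complex.I • χ))
    (hi (φ - Complex.I • χ))
  rw [e]
  refine ⟨i, j.trans ?_⟩
  rw [ht, ht, ht, ht, e2]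
  ring

variable [CompleteSpace H]

theorem inner_eq_norm_sqrt_sq {A : H →L[ℂ] H} (hA : A.IsPositive) (v : H) :
    ⟪v, A v⟫_ℂ = ((‖CFC.sqrt A v‖ ^ 2 : ℝ) : ℂ) := by
  have hA' := (ContinuousLinearMap.nonneg_iff_isPositive A).mpr hA
  have h1 : CFC.sqrt A * CFC.sqrt A = A := CFC.sqrt_mul_sqrt_self A
  have h2 : IsSelfAdjoint (CFC.sqrt A) := (CFC.sqrt_nonneg A).isSelfAdjoint
  conv_lhs => rw [← h1]
  rw [mul_apply_eq_comp, ← ContinuousLinearMap.adjoint_inner_left,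
    h2.adjoint_eq, inner_self_eq_norm_sq_to_K]
  norm_cast

theorem inner_sqrt_comm {A : H →L[ℂ] H} (v w : H) :
    ⟪v, CFC.sqrt A w⟫_ℂ = ⟪CFC.sqrt A v, w⟫_ℂ := by
  have h2 : IsSelfAdjoint (CFC.sqrt A) := (CFC.sqrt_nonneg A).isSelfAdjoint
  rw [← ContinuousLinearMap.adjoint_inner_left, h2.adjoint_eq]

end Hilbert

/-! ### An unbounded positive operator is determined by its form -/

section SquareRoot

variable {H : Type} [NormedAddCommGroup H] [InnerProductSpace ℂ H] [CompleteSpace H]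

theorem IsSelfAdjoint.inner_apply_comm {R : H →ₗ.[ℂ] H} (h : IsSelfAdjoint R)
    (v w : R.domain) : ⟪R v, (w : H)⟫_ℂ = ⟪(v : H), R w⟫_ℂ := by
  have h1 := LinearPMap.adjoint_isFormalAdjoint h.dense_domain
  rw [(LinearPMap.isSelfAdjoint_def).mp h] at h1
  exact h1 v w

theorem IsSelfAdjoint.mem_graph_of_forall_inner {R : H →ₗ.[ℂ] H} (h : IsSelfAdjoint R) {y w : H}
    (hw : ∀ x : R.domain, ⟪w, (x : H)⟫_ℂ = ⟪y, R x⟫_ℂ) : (y, w) ∈ R.graph := by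
  have hy : y ∈ R.adjoint.domain := LinearPMap.mem_adjoint_domain_of_exists y ⟨w, hw⟩
  have h2 := LinearPMap.adjoint_apply_eq h.dense_domain ⟨y, hy⟩ hw
  have h3 : (y, w) ∈ R.adjoint.graph := (LinearPMap.mem_graph_iff _).mpr ⟨⟨y, hy⟩, rfl, h2⟩
  rwa [(LinearPMap.isSelfAdjoint_def).mp h] at h3

/-- If Rv is in dom R, then ⟨R(Rv), x⟩ = ⟨Rv, Rx⟩ = ⟨R₀v, R₀x⟩ for every x in the common domain.
Hence R₀v lies in dom R₀* = dom R₀ with R₀(R₀v) = R(Rv). -/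
theorem IsSqrtOf.le_of_inner_eq {R R₀ D D₀ : H →ₗ.[ℂ] H} (h : IsSqrtOf R D) (h₀ : IsSqrtOf R₀ D₀)
    (hd : R.domain = R₀.domain)
    (hi : ∀ u v (hu : u ∈ R.domain) (hv : v ∈ R.domain) (hu' : u ∈ R₀.domain)
      (hv' : v ∈ R₀.domain), ⟪R ⟨u, hu⟩, R ⟨v, hv⟩⟫_ℂ = ⟪R₀ ⟨u, hu'⟩, R₀ ⟨v, hv'⟩⟫_ℂ) :
    D ≤ D₀ := by
  refine LinearPMap.le_of_le_graph ?_
  rintro ⟨v, w⟩ hvw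
  obtain ⟨u, hvu, huw⟩ := (h.2 v w).mp hvw
  obtain ⟨⟨v, hv⟩, rfl, rfl⟩ := (LinearPMap.mem_graph_iff _).mp hvu
  obtain ⟨⟨u', hu⟩, hu', rfl⟩ := (LinearPMap.mem_graph_iff _).mp huw
  dsimp only at hu' ⊢
  have hv₀ : v ∈ R₀.domain := hd ▸ hv
  refine (h₀.2 _ _).mpr ⟨R₀ ⟨v, hv₀⟩, (LinearPMap.mem_graph_iff _).mpr ⟨⟨v, hv₀⟩, rfl, rfl⟩, ?_⟩
  refine h₀.1.1.mem_graph_of_forall_inner fun x => ?_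
  have hx : (x : H) ∈ R.domain := by rw [hd]; exact x.2
  rw [← hi v x hv hx hv₀ x.2, ← hu']
  exact h.1.1.inner_apply_comm ⟨u', hu⟩ ⟨x, hx⟩

theorem IsSqrtOf.eq_of_inner_eq {R R₀ D D₀ : H →ₗ.[ℂ] H} (h : IsSqrtOf R D) (h₀ : IsSqrtOf R₀ D₀)
    (hd : R.domain = R₀.domain)
    (hi : ∀ u v (hu : u ∈ R.domain) (hv : v ∈ R.domain) (hu' : u ∈ R₀.domain)
      (hv' : v ∈ R₀.domain), ⟪R ⟨u, hu⟩, R ⟨v, hv⟩⟫_ℂ = ⟪R₀ ⟨u, hu'⟩, R₀ ⟨v, hv'⟩⟫_ℂ) :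
    D = D₀ :=
  le_antisymm (h.le_of_inner_eq h₀ hd hi)
    (h₀.le_of_inner_eq h hd.symm fun u v hu hv hu' hv' => (hi u v hu' hv' hu hv).symm)

theorem sqNormOrTop_of_mem {R : H →ₗ.[ℂ] H} {v : H} (hv : v ∈ R.domain) :
    sqNormOrTop R v = ‖R ⟨v, hv⟩‖ₑ ^ 2 := by
  rw [sqNormOrTop, dif_pos hv, ENNReal.ofReal_pow (norm_nonneg _), ofReal_norm]

theorem sqNormOrTop_lt_top {R : H →ₗ.[ℂ] H} {v : H} : sqNormOrTop R v < ⊤ ↔ v ∈ R.domain := by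
  by_cases hv : v ∈ R.domain
  · simp [sqNormOrTop_of_mem hv, hv]
  · simp [sqNormOrTop, hv]

end SquareRoot

/-! ### Abstract consequences of the orthogonality relation -/

section Orthogonality

variable {H : Type} [NormedAddCommGroup H] [InnerProductSpace ℂ H] [CompleteSpace H]
variable {G : Type} [Group G] [MeasurableSpace G]

/-- The orthogonality relation `∫ dg |⟨φ|U_g|ψ⟩|² = ‖φ‖² ‖R ψ‖²` in `[0, ∞]`. -/
structure HasOrthogonality (μ : Measure G) (U : G → H ≃ₗᵢ[ℂ] H) (R : H →ₗ.[ℂ] H) : Prop where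
  aestronglyMeasurable : ∀ φ ψ : H, AEStronglyMeasurable (fun g => ⟪φ, U g ψ⟫_ℂ) μ
  lintegral_eq : ∀ φ ψ : H, ∫⁻ g, ‖⟪φ, U g ψ⟫_ℂ‖ₑ ^ 2 ∂μ = ‖φ‖ₑ ^ 2 * sqNormOrTop R ψ

variable {μ : Measure G} {U : G → H ≃ₗᵢ[ℂ] H} {R : H →ₗ.[ℂ] H}

theorem HasOrthogonality.lintegral_ofReal (h : HasOrthogonality μ U R) (φ ψ : H) :
    ∫⁻ g, ENNReal.ofReal (‖⟪φ, U g ψ⟫_ℂ‖ ^ 2) ∂μ = ‖φ‖ₑ ^ 2 * sqNormOrTop R ψ := by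
  rw [← h.lintegral_eq]
  simp only [ENNReal.ofReal_pow (norm_nonneg _), ofReal_norm]

theorem HasOrthogonality.integrable_sq_iff (h : HasOrthogonality μ U R) (φ ψ : H) :
    Integrable (fun g => ‖⟪φ, U g ψ⟫_ℂ‖ ^ 2) μ ↔ ‖φ‖ₑ ^ 2 * sqNormOrTop R ψ < ⊤ := by
  rw [← h.lintegral_ofReal, Integrable, hasFiniteIntegral_iff_ofReal (by filter_upwards; simp)]
  exact and_iff_right ((h.aestronglyMeasurable φ ψ).norm.pow 2)

theorem HasOrthogonality.isAdmissibleVec_iff (h : HasOrthogonality μ U R) (ψ : H) :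
    IsAdmissibleVec μ U ψ ↔ ψ ∈ R.domain := by
  rw [IsAdmissibleVec, h.integrable_sq_iff, ← sqNormOrTop_lt_top]
  -- The factor ‖ψ‖² can be cancelled only when it is nonzero, since 0 · ∞ = 0 in [0, ∞].
  rcases eq_or_ne ψ 0 with rfl | hψ
  · simp [sqNormOrTop_lt_top]
  · have : ‖ψ‖ₑ ^ 2 ≠ 0 := by simpa using hψ
    constructor
    · intro h1
      by_contra h2
      rw [not_lt_top_iff.mp h2, ENNReal.mul_top this] at h1
      exact lt_irrefl _ h1
    · intro h1
      exact ENNReal.mul_lt_top (by simp) h1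

/-- The integrand is a matrix element of the rank-one operator on U_g ψ, so polarization in φ, χ
suffices; `HasOrthogonality.integral_eq` then polarizes in ψ, ψ'. -/
theorem HasOrthogonality.integral_diag (h : HasOrthogonality μ U R) (ψ : R.domain) (φ χ : H) :
    Integrable (fun g => ⟪φ, U g ψ⟫_ℂ * ⟪U g ψ, χ⟫_ℂ) μ ∧
      ∫ g, ⟪φ, U g ψ⟫_ℂ * ⟪U g ψ, χ⟫_ℂ ∂μ = ⟪R ψ, R ψ⟫_ℂ * ⟪φ, χ⟫_ℂ := by
  let B : G → H →ₗ[ℂ] H := fun g => InnerProductSpace.rankOne ℂ (U g ψ) (U g ψ)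
  have hB : ∀ φ χ g, ⟪φ, B g χ⟫_ℂ = ⟪φ, U g ψ⟫_ℂ * ⟪U g ψ, χ⟫_ℂ := by
    intro φ χ g
    simp [B, mul_comm]
  have hD : ∀ φ g, ⟪φ, B g φ⟫_ℂ = ((‖⟪φ, U g ψ⟫_ℂ‖ ^ 2 : ℝ) : ℂ) := by
    intro φ g
    rw [hB, ← inner_conj_symm (U g ψ) φ, Complex.mul_conj, Complex.normSq_eq_norm_sq]
  have hi : ∀ φ, Integrable (fun g => ‖⟪φ, U g ψ⟫_ℂ‖ ^ 2) μ := fun φ => by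
    rw [h.integrable_sq_iff, sqNormOrTop_of_mem ψ.2]
    exact ENNReal.mul_lt_top (by simp) (by simp)
  simp only [← hB]
  refine integral_inner_eq_of_diag (fun φ => ?_) (fun φ => ?_) φ χ
  · simp only [hD]
    exact (hi φ).ofReal
  · simp only [hD]
    rw [integral_complex_ofReal, integral_eq_lintegral_of_nonneg_ae (by filter_upwards; simp)
      (hi φ).1, h.lintegral_ofReal, sqNormOrTop_of_mem ψ.2, inner_self_eq_norm_sq_to_K,
      inner_self_eq_norm_sq_to_K]
    simp [mul_comm]

theorem polarization_mul (V : H →ₗ[ℂ] H) (ψ ψ' φ χ : H) :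
    ⟪φ, V ψ⟫_ℂ * ⟪V ψ', χ⟫_ℂ = (⟪φ, V (ψ' + ψ)⟫_ℂ * ⟪V (ψ' + ψ), χ⟫_ℂ
      - ⟪φ, V (ψ' - ψ)⟫_ℂ * ⟪V (ψ' - ψ), χ⟫_ℂ
      - Complex.I * (⟪φ, V (ψ' + Complex.I • ψ)⟫_ℂ * ⟪V (ψ' + Complex.I • ψ), χ⟫_ℂ)
      + Complex.I * (⟪φ, V (ψ' - Complex.I • ψ)⟫_ℂ * ⟪V (ψ' - Complex.I • ψ), χ⟫_ℂ)) / 4 := by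
  simp only [map_add, map_sub, map_smul, inner_add_left, inner_add_right, inner_sub_left,
    inner_sub_right, inner_smul_left, inner_smul_right, Complex.conj_I]
  linear_combination (⟪φ, V ψ⟫_ℂ * ⟪V ψ', χ⟫_ℂ - ⟪φ, V ψ'⟫_ℂ * ⟪V ψ, χ⟫_ℂ) / 2 * Complex.I_sq

theorem HasOrthogonality.integral_eq (h : HasOrthogonality μ U R) (ψ ψ' : R.domain) (φ χ : H) :
    Integrable (fun g => ⟪φ, U g ψ⟫_ℂ * ⟪U g ψ', χ⟫_ℂ) μ ∧
      ∫ g, ⟪φ, U g ψ⟫_ℂ * ⟪U g ψ', χ⟫_ℂ ∂μ = ⟪R ψ', R ψ⟫_ℂ * ⟪φ, χ⟫_ℂ := by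
  have e : (fun g => ⟪φ, U g ψ⟫_ℂ * ⟪U g ψ', χ⟫_ℂ) = _ :=
    funext fun g => polarization_mul (U g).toLinearMap (ψ : H) (ψ' : H) φ χ
  have e2 := polarization_apply LinearMap.id (R ψ') (R ψ)
  simp only [LinearMap.id_coe, id_eq] at e2
  obtain ⟨i1, j1⟩ := h.integral_diag (ψ' + ψ) φ χ
  obtain ⟨i2, j2⟩ := h.integral_diag (ψ' - ψ) φ χ
  obtain ⟨i3, j3⟩ := h.integral_diag (ψ' + Complex.I • ψ) φ χ
  obtain ⟨i4, j4⟩ := h.integral_diag (ψ' - Complex.I • ψ) φ χ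
  simp only [R.map_add, R.map_sub, R.map_smul] at j1 j2 j3 j4
  obtain ⟨i, j⟩ := integral_polarization i1 i2 i3 i4
  rw [e]
  refine ⟨i, j.trans ?_⟩
  rw [j1, j2, j3, j4, e2]
  ring

theorem conjOp_apply (A : H →L[ℂ] H) (g : G) (χ : H) :
    conjOp U A g χ = U g (A ((U g).symm χ)) := rfl

theorem inner_map_eq_inner_symm (V : H ≃ₗᵢ[ℂ] H) (φ χ : H) : ⟪φ, V χ⟫_ℂ = ⟪V.symm φ, χ⟫_ℂ := by
  rw [← V.inner_map_map (V.symm φ), V.apply_symm_apply]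

/-- The diagonal element is ‖A^{1/2} U_g† φ‖², expanded by Parseval. Each term is a squared matrix
element of U_g, to which the orthogonality relation applies. -/
theorem inner_conjOp_self {A : H →L[ℂ] H} (hA : A.IsPositive) {ι : Type} (b : HilbertBasis ι ℂ H)
    (g : G) (φ : H) : ⟪φ, conjOp U A g φ⟫_ℂ
      = (((∑' i, ‖⟪φ, U g (CFC.sqrt A (b i))⟫_ℂ‖ₑ ^ 2).toReal : ℝ) : ℂ) := by
  have h1 : ∀ i, ⟪φ, U g (CFC.sqrt A (b i))⟫_ℂ
      = (starRingEnd ℂ) ⟪b i, CFC.sqrt A ((U g).symm φ)⟫_ℂ := fun i => by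
    rw [inner_map_eq_inner_symm, inner_sqrt_comm, inner_conj_symm]
  simp only [h1, RCLike.enorm_conj, b.tsum_enorm_inner_sq]
  rw [conjOp_apply, inner_map_eq_inner_symm, inner_eq_norm_sqrt_sq hA]
  simp

theorem HasOrthogonality.lintegral_tsum [TopologicalSpace.SeparableSpace H]
    (h : HasOrthogonality μ U R) (A : H →L[ℂ] H) {ι : Type} (b : HilbertBasis ι ℂ H) (φ : H) :
    AEMeasurable (fun g => ∑' i, ‖⟪φ, U g (CFC.sqrt A (b i))⟫_ℂ‖ₑ ^ 2) μ ∧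
    ∫⁻ g, ∑' i, ‖⟪φ, U g (CFC.sqrt A (b i))⟫_ℂ‖ₑ ^ 2 ∂μ = ‖φ‖ₑ ^ 2 * traceAgainst R A b := by
  have := b.orthonormal.countable_of_separableSpace
  have hm : ∀ i, AEMeasurable (fun g => ‖⟪φ, U g (CFC.sqrt A (b i))⟫_ℂ‖ₑ ^ 2) μ := fun i =>
    (h.aestronglyMeasurable φ _).enorm.pow_const 2
  refine ⟨AEMeasurable.tsum hm, ?_⟩
  rw [MeasureTheory.lintegral_tsum hm, traceAgainst, ← ENNReal.tsum_mul_left]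
  exact tsum_congr fun i => h.lintegral_eq φ _

theorem tsum_enorm_ne_top {A : H →L[ℂ] H} {ι : Type} (b : HilbertBasis ι ℂ H) (g : G) (φ : H) :
    ∑' i, ‖⟪φ, U g (CFC.sqrt A (b i))⟫_ℂ‖ₑ ^ 2 ≠ ⊤ := by
  have h1 : ∀ i, ⟪φ, U g (CFC.sqrt A (b i))⟫_ℂ
      = (starRingEnd ℂ) ⟪b i, CFC.sqrt A ((U g).symm φ)⟫_ℂ := fun i => by
    rw [inner_map_eq_inner_symm, inner_sqrt_comm, inner_conj_symm]
  simp only [h1, RCLike.enorm_conj, b.tsum_enorm_inner_sq]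
  simp

/-- By Tonelli the diagonal elements integrate to ‖φ‖² Tr[DA] in [0, ∞]. A unit vector φ shows that
admissibility forces a finite trace; conversely, finiteness on the diagonal extends by polarization.
-/
theorem HasOrthogonality.isAdmissibleOp_iff [TopologicalSpace.SeparableSpace H] [Nontrivial H]
    (h : HasOrthogonality μ U R) {A : H →L[ℂ] H} (hA : A.IsPositive) {ι : Type}
    (b : HilbertBasis ι ℂ H) :
    (IsAdmissibleOp μ U A ↔ traceAgainst R A b < ⊤) ∧
      (IsAdmissibleOp μ U A → ∀ φ χ : H,
        groupAverage μ U A φ χ = ((traceAgainst R A b).toReal : ℂ) * ⟪φ, χ⟫_ℂ) := by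
  have hd : IsAdmissibleOp μ U A → traceAgainst R A b < ⊤ := fun ha => by
    obtain ⟨φ, hφ⟩ := exists_norm_eq H zero_le_one
    have h1 := (ha φ φ).2
    simp only [inner_conjOp_self hA b] at h1
    have h2 : ∫⁻ g, ∑' i, ‖⟪φ, U g (CFC.sqrt A (b i))⟫_ℂ‖ₑ ^ 2 ∂μ < ⊤ := by
      rw [HasFiniteIntegral] at h1
      refine (lintegral_congr fun g => ?_).trans_lt h1
      rw [← ofReal_norm, Complex.norm_real, Real.norm_of_nonneg ENNReal.toReal_nonneg,
        ENNReal.ofReal_toReal (tsum_enorm_ne_top b g φ)]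
    rw [(h.lintegral_tsum A b φ).2] at h2
    have h3 : ‖φ‖ₑ = 1 := by rw [← ofReal_norm, hφ, ENNReal.ofReal_one]
    simpa [h3] using h2
  have key : traceAgainst R A b < ⊤ → ∀ φ χ,
      Integrable (fun g => ⟪φ, (conjOp U A g).toLinearMap χ⟫_ℂ) μ ∧
      ∫ g, ⟪φ, (conjOp U A g).toLinearMap χ⟫_ℂ ∂μ
        = ((traceAgainst R A b).toReal : ℂ) * ⟪φ, χ⟫_ℂ := fun hT => by
    have hfin : ∀ φ, ∫⁻ g, ∑' i, ‖⟪φ, U g (CFC.sqrt A (b i))⟫_ℂ‖ₑ ^ 2 ∂μ ≠ ⊤ := fun φ => by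
      rw [(h.lintegral_tsum A b φ).2]
      exact (ENNReal.mul_lt_top (by simp) hT).ne
    refine fun φ χ => integral_inner_eq_of_diag (fun φ => ?_) (fun φ => ?_) φ χ
    · simp only [ContinuousLinearMap.coe_coe, inner_conjOp_self hA b]
      exact (integrable_toReal_of_lintegral_ne_top (h.lintegral_tsum A b φ).1 (hfin φ)).ofReal
    · simp only [ContinuousLinearMap.coe_coe, inner_conjOp_self hA b]
      rw [integral_complex_ofReal, integral_toReal (h.lintegral_tsum A b φ).1
        (Filter.Eventually.of_forall fun g => (tsum_enorm_ne_top b g φ).lt_top),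
        (h.lintegral_tsum A b φ).2, inner_self_eq_norm_sq_to_K]
      simp [mul_comm]
  exact ⟨⟨hd, fun hT φ χ => (key hT φ χ).1⟩, fun ha φ χ => (key (hd ha) φ χ).2⟩

/-- For uniqueness, the admissible vectors fix the domain of the square root, and the orthogonality
relation at φ = χ of norm one fixes its form. -/
theorem HasOrthogonality.isDMCOperator_iff [TopologicalSpace.SeparableSpace H] [Nontrivial H]
    (h : HasOrthogonality μ U R) {D₀ : H →ₗ.[ℂ] H} (hD₀ : IsPositiveSelfAdjoint D₀)
    (hR : IsSqrtOf R D₀) (D : H →ₗ.[ℂ] H) : IsDMCOperator μ U D ↔ D = D₀ := by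
  constructor
  · rintro ⟨-, R', hR', hdom, horth, -⟩
    have hd : R'.domain = R.domain := by
      ext ψ
      rw [← hdom, h.isAdmissibleVec_iff]
    refine hR'.eq_of_inner_eq hR hd fun u v hu hv hu' hv' => ?_
    obtain ⟨φ, hφ⟩ := exists_norm_eq H zero_le_one
    have h1 := (horth ⟨v, hv⟩ ⟨u, hu⟩ φ φ).2
    have h2 := (h.integral_eq ⟨v, hv'⟩ ⟨u, hu'⟩ φ φ).2
    simpa [inner_self_eq_norm_sq_to_K, hφ] using h1.symm.trans h2
  · rintro rfl
    exact ⟨hD₀, R, hR, h.isAdmissibleVec_iff, h.integral_eq, fun A hA ι b =>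
      h.isAdmissibleOp_iff hA b⟩

/-- For ψ in a closed invariant K and φ ≠ 0 orthogonal to K, all matrix elements vanish, so ‖φ‖²
‖Rψ‖² = 0; injectivity of R then gives ψ = 0. -/
theorem HasOrthogonality.isIrreducibleRep [Nontrivial H] (h : HasOrthogonality μ U R)
    (hR : ∀ ψ : R.domain, R ψ = 0 → (ψ : H) = 0) : IsIrreducibleRep U := by
  refine ⟨inferInstance, fun K hK hinv => ?_⟩
  by_contra! hne
  obtain ⟨ψ, hψ, hψ0⟩ := (Submodule.ne_bot_iff K).mp hne.1
  have : CompleteSpace K := hK.completeSpace_coe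
  obtain ⟨φ, hφ, hφ0⟩ := (Submodule.ne_bot_iff Kᗮ).mp
    fun h => hne.2 (K.orthogonal_eq_bot_iff.mp h)
  have h1 := h.lintegral_eq φ ψ
  have h2 : ∀ g, ⟪φ, U g ψ⟫_ℂ = 0 := fun g =>
    K.inner_left_of_mem_orthogonal (hinv g ψ hψ) hφ
  simp only [h2, enorm_zero, ne_eq, OfNat.ofNat_ne_zero, not_false_eq_true, zero_pow,
    lintegral_zero] at h1
  have h3 : sqNormOrTop R ψ = 0 := by simpa [hφ0] using h1.symm
  have hd : ψ ∈ R.domain := sqNormOrTop_lt_top.mp (h3 ▸ ENNReal.zero_lt_top)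
  rw [sqNormOrTop_of_mem hd] at h3
  exact hψ0 (hR ⟨ψ, hd⟩ (by simpa using h3))

theorem HasOrthogonality.isCovariantSeed_rankOne (h : HasOrthogonality μ U R) (η : R.domain)
    (hη : ‖R η‖ = 1) :
    IsCovariantSeed μ U (InnerProductSpace.rankOne ℂ (η : H) (η : H)) := by
  have h1 : ∀ φ χ g, ⟪φ, conjOp U (InnerProductSpace.rankOne ℂ (η : H) (η : H)) g χ⟫_ℂ
      = ⟪φ, U g η⟫_ℂ * ⟪U g η, χ⟫_ℂ := fun φ χ g => by
    rw [conjOp_apply, InnerProductSpace.rankOne_apply, map_smul, inner_smul_right, mul_comm,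
      ← (U g).inner_map_map (η : H), (U g).apply_symm_apply]
  refine ⟨InnerProductSpace.isPositive_rankOne_self _, fun φ χ => ?_, fun φ χ => ?_⟩
  · simp only [h1]
    exact (h.integral_eq η η φ χ).1
  · simp only [groupAverage, h1]
    rw [(h.integral_eq η η φ χ).2, inner_self_eq_norm_sq_to_K, hη]
    simp

theorem probDensity_self (ξ : H →L[ℂ] H) (ψ : H) (g : G) :
    probDensity U ξ ψ g g = (⟪ψ, ξ ψ⟫_ℂ).re := by
  rw [probDensity, conjOp_apply, (U g).symm_apply_apply, (U g).inner_map_map]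

theorem probDensity_rankOne_self (η ψ : H) (g : G) :
    probDensity U (InnerProductSpace.rankOne ℂ η η) ψ g g = ‖⟪η, ψ⟫_ℂ‖ ^ 2 := by
  rw [probDensity_self, InnerProductSpace.rankOne_apply, inner_smul_right,
    ← inner_conj_symm ψ η, Complex.mul_conj, Complex.normSq_eq_norm_sq, Complex.ofReal_re]

/-- The hypothesis on ζ is the weak form of Rζ = ψ. It moves R onto ξ^{1/2}e_i, so Cauchy-Schwarz
term by term produces the trace of ξ against R, which normalization makes 1. -/
theorem HasOrthogonality.probDensity_le [TopologicalSpace.SeparableSpace H] [Nontrivial H]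
    (h : HasOrthogonality μ U R) {ψ ζ : H}
    (hζ : ∀ v : R.domain, ⟪(v : H), ψ⟫_ℂ = ⟪R v, ζ⟫_ℂ) {ξ : H →L[ℂ] H}
    (hξ : IsCovariantSeed μ U ξ) (g : G) : probDensity U ξ ψ g g ≤ ‖ζ‖ ^ 2 := by
  obtain ⟨hpos, hadm, hone⟩ := hξ
  obtain ⟨w, b, -⟩ := exists_hilbertBasis ℂ H
  obtain ⟨h1, h2⟩ := h.isAdmissibleOp_iff hpos b
  have hT : traceAgainst R ξ b = 1 := by
    obtain ⟨φ, hφ⟩ := exists_norm_eq H zero_le_one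
    have h3 := (h2 hadm φ φ).symm.trans (hone φ φ)
    rw [inner_self_eq_norm_sq_to_K, hφ] at h3
    have h4 : (traceAgainst R ξ b).toReal = 1 := by
      have : (((traceAgainst R ξ b).toReal : ℝ) : ℂ) = 1 := by simpa using h3
      exact_mod_cast this
    -- The value 1 excludes an infinite trace, since `toReal` sends ∞ to 0.
    rwa [ENNReal.toReal_eq_one_iff] at h4
  rw [probDensity_self, inner_eq_norm_sqrt_sq hpos, Complex.ofReal_re]
  have h5 : ‖CFC.sqrt ξ ψ‖ₑ ^ 2 ≤ ‖ζ‖ₑ ^ 2 := by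
    rw [← b.tsum_enorm_inner_sq, ← one_mul (‖ζ‖ₑ ^ 2), ← hT, traceAgainst,
      ← ENNReal.tsum_mul_right]
    refine ENNReal.tsum_le_tsum fun i => ?_
    have hfin : sqNormOrTop R (CFC.sqrt ξ (b i)) < ⊤ :=
      (ENNReal.le_tsum (f := fun i => sqNormOrTop R (CFC.sqrt ξ (b i))) i).trans_lt
        (hT.trans_lt ENNReal.one_lt_top)
    have hd := sqNormOrTop_lt_top.mp hfin
    rw [inner_sqrt_comm, sqNormOrTop_of_mem hd, hζ ⟨_, hd⟩, ← mul_pow]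
    gcongr
    rw [← ofReal_norm, ← ofReal_norm, ← ofReal_norm, ← ENNReal.ofReal_mul (norm_nonneg _)]
    exact ENNReal.ofReal_le_ofReal (norm_inner_le_norm _ _)
  rw [← ofReal_norm, ← ofReal_norm, ← ENNReal.ofReal_pow (norm_nonneg _),
    ← ENNReal.ofReal_pow (norm_nonneg _), ENNReal.ofReal_le_ofReal_iff (by positivity)] at h5
  exact h5

end Orthogonality

/-! ### Plancherel on L¹ and the representation in the variable y -/

section FourierL2

open FourierTransform SchwartzMap

theorem ae_eq_of_forall_integral_schwartz_mul {f f' : ℝ → ℂ} (hf : LocallyIntegrable f)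
    (hf' : LocallyIntegrable f')
    (h : ∀ g : 𝓢(ℝ, ℂ), ∫ x, g x * f x = ∫ x, g x * f' x) : f =ᵐ[volume] f' := by
  refine ae_eq_of_integral_contDiff_smul_eq hf hf' fun g hg hc => ?_
  have hc' : HasCompactSupport (fun x => (g x : ℂ)) :=
    hc.comp_left (g := fun r : ℝ => (r : ℂ)) Complex.ofReal_zero
  simp only [Complex.real_smul]
  exact h (hc'.toSchwartzMap (Complex.ofRealCLM.contDiff.comp hg))

theorem integral_schwartz_mul_fourier (g : 𝓢(ℝ, ℂ)) {h : ℝ → ℂ} (hh : Integrable h) :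
    ∫ x, g x * 𝓕 h x = ∫ x, (𝓕 g) x * h x := by
  have := VectorFourier.integral_fourierIntegral_smul_eq_flip (L := innerₗ ℝ) (μ := volume)
    (ν := volume) Real.continuous_fourierChar continuous_inner hh g.integrable
  simp only [flip_innerₗ, smul_eq_mul] at this
  simp only [mul_comm (g _), mul_comm ((𝓕 g) _)]
  exact this

theorem integral_schwartz_mul_fourier_Lp (g : 𝓢(ℝ, ℂ)) (f : OneMode) :
    ∫ x, g x * Lp.fourierTransformₗᵢ ℝ ℂ f x = ∫ x, (𝓕 g) x * f x := by
  have := congrArg (fun T => T g) (Lp.fourier_toTemperedDistribution_eq f)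
  simp only [TemperedDistribution.fourier_apply, Lp.toTemperedDistribution_apply,
    smul_eq_mul] at this
  exact this.symm

theorem continuous_fourier_of_integrable {h : ℝ → ℂ} (hh : Integrable h) : Continuous (𝓕 h) :=
  VectorFourier.fourierIntegral_continuous Real.continuous_fourierChar continuous_inner hh

/-- The multiplication formula ∫ g ĥ = ∫ ĝ h holds for both transforms, so they agree against every
Schwartz function. -/
theorem fourierTransform_toLp_ae_eq {h : ℝ → ℂ} (h1 : Integrable h) (h2 : MemLp h 2) :
    Lp.fourierTransformₗᵢ ℝ ℂ h2.toLp =ᵐ[volume] 𝓕 h := by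
  refine ae_eq_of_forall_integral_schwartz_mul
    ((Lp.memLp _).locallyIntegrable (by norm_num))
    (continuous_fourier_of_integrable h1).locallyIntegrable fun g => ?_
  rw [integral_schwartz_mul_fourier_Lp, integral_schwartz_mul_fourier g h1]
  refine integral_congr_ae ?_
  filter_upwards [h2.coeFn_toLp] with x hx
  rw [hx]

/-- The L² preimage k of ĥ has the same pairings as h with all Fourier transforms of Schwartz
functions. These exhaust the Schwartz space, so k = h almost everywhere. -/
theorem memLp_two_of_fourier {h : ℝ → ℂ} (h1 : Integrable h) (h2 : MemLp (𝓕 h) 2) :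
    MemLp h 2 := by
  set k : OneMode := (Lp.fourierTransformₗᵢ ℝ ℂ).symm h2.toLp with hk
  have hk' : Lp.fourierTransformₗᵢ ℝ ℂ k = h2.toLp := LinearIsometryEquiv.apply_symm_apply _ _
  have : (k : ℝ → ℂ) =ᵐ[volume] h := by
    refine ae_eq_of_forall_integral_schwartz_mul ((Lp.memLp k).locallyIntegrable (by norm_num))
      h1.locallyIntegrable fun g => ?_
    obtain ⟨g', rfl⟩ : ∃ g' : 𝓢(ℝ, ℂ), 𝓕 g' = g := ⟨𝓕⁻ g, fourier_fourierInv_eq g⟩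
    rw [← integral_schwartz_mul_fourier_Lp, ← integral_schwartz_mul_fourier g' h1, hk']
    refine integral_congr_ae ?_
    filter_upwards [h2.coeFn_toLp] with x hx
    rw [hx]
  exact (memLp_congr_ae this).mp (Lp.memLp k)

theorem eLpNorm_two_sq {f : ℝ → ℂ} {μ : Measure ℝ} :
    eLpNorm f 2 μ ^ 2 = ∫⁻ x, ‖f x‖ₑ ^ 2 ∂μ := by
  rw [eLpNorm_eq_lintegral_rpow_enorm_toReal (by norm_num) (by norm_num)]
  simp only [ENNReal.toReal_ofNat, ENNReal.rpow_ofNat, one_div]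
  rw [← ENNReal.rpow_natCast, ← ENNReal.rpow_mul]
  norm_num

/-- The overlaps to which this is applied are products of two L² functions, hence integrable but
perhaps not square integrable. Then both sides are ∞, by `memLp_two_of_fourier`. -/
theorem lintegral_fourier_sq {h : ℝ → ℂ} (h1 : Integrable h) :
    ∫⁻ w, ‖𝓕 h w‖ₑ ^ 2 = ∫⁻ x, ‖h x‖ₑ ^ 2 := by
  rw [← eLpNorm_two_sq, ← eLpNorm_two_sq]
  congr 1
  by_cases h2 : MemLp h 2
  · rw [← eLpNorm_congr_ae (fourierTransform_toLp_ae_eq h1 h2), ← eLpNorm_congr_ae h2.coeFn_toLp]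
    have := (Lp.fourierTransformₗᵢ ℝ ℂ).norm_map h2.toLp
    rwa [Lp.norm_def, Lp.norm_def, ENNReal.toReal_eq_toReal_iff' (Lp.eLpNorm_ne_top _)
      (Lp.eLpNorm_ne_top _)] at this
  · have h3 : ¬ MemLp (𝓕 h) 2 := fun h3 => h2 (memLp_two_of_fourier h1 h3)
    have e1 : eLpNorm h 2 = ⊤ := by
      by_contra e
      exact h2 ⟨h1.1, lt_top_iff_ne_top.mpr e⟩
    have e2 : eLpNorm (𝓕 h) 2 = ⊤ := by
      by_contra e
      exact h3 ⟨(continuous_fourier_of_integrable h1).aestronglyMeasurable,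
        lt_top_iff_ne_top.mpr e⟩
    rw [e1, e2]

theorem memLp_phase (a : ℝ) (f : OneMode) :
    MemLp (fun y => Complex.exp ((a * y : ℝ) * Complex.I) * f y) 2 volume :=
  (Lp.memLp f).of_le (AEStronglyMeasurable.mul (by fun_prop) (Lp.aestronglyMeasurable f))
    (by filter_upwards with y; rw [norm_mul, Complex.norm_exp_ofReal_mul_I, one_mul])

/-- Multiplication by the phase `e^{i a y}`. -/
def phaseOp (a : ℝ) : OneMode →ₗᵢ[ℂ] OneMode where
  toFun f := (memLp_phase a f).toLp
  map_add' f g := by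
    rw [← MemLp.toLp_add]
    apply MemLp.toLp_congr
    filter_upwards [Lp.coeFn_add f g] with y hy
    rw [hy, Pi.add_apply, Pi.add_apply, mul_add]
  map_smul' c f := by
    rw [RingHom.id_apply, ← MemLp.toLp_const_smul]
    apply MemLp.toLp_congr
    filter_upwards [Lp.coeFn_smul c f] with y hy
    rw [hy, Pi.smul_apply, Pi.smul_apply, smul_eq_mul, smul_eq_mul]
    ring
  norm_map' f := by
    change ‖(memLp_phase a f).toLp‖ = ‖f‖
    rw [Lp.norm_toLp, Lp.norm_def]
    congr 1
    refine eLpNorm_congr_norm_ae ?_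
    filter_upwards with y
    rw [norm_mul, Complex.norm_exp_ofReal_mul_I, one_mul]

theorem phaseOp_ae (a : ℝ) (f : OneMode) :
    phaseOp a f =ᵐ[volume] fun y => Complex.exp ((a * y : ℝ) * Complex.I) * f y :=
  (memLp_phase a f).coeFn_toLp

theorem fourier_comp_affine (c b : ℝ) (hc : c ≠ 0) (k : ℂ) (f : ℝ → ℂ) (w : ℝ) :
    𝓕 (fun x => k * f (c⁻¹ * (x - b))) w
      = ((|c| : ℝ) : ℂ) * k * Complex.exp ((-2 * Real.pi * b * w : ℝ) * Complex.I) * 𝓕 f (c * w) := by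
  rw [Real.fourier_real_eq_integral_exp_smul, Real.fourier_real_eq_integral_exp_smul]
  let F : ℝ → ℂ := fun u =>
    Complex.exp ((-2 * Real.pi * (c * u + b) * w : ℝ) * Complex.I) • (k * f u)
  have h1 : ∀ x, Complex.exp ((-2 * Real.pi * x * w : ℝ) * Complex.I) • (k * f (c⁻¹ * (x - b)))
      = F (c⁻¹ * (x - b)) := fun x => by
    simp only [F]
    rw [← mul_assoc c, mul_inv_cancel₀ hc, one_mul, sub_add_cancel]
  simp only [h1]
  rw [integral_sub_right_eq_self (fun x => F (c⁻¹ * x)) b, Measure.integral_comp_mul_left, inv_inv,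
    Complex.real_smul, ← integral_const_mul, ← integral_const_mul]
  congr 1
  ext u
  simp only [F, smul_eq_mul]
  have : ((-2 * Real.pi * (c * u + b) * w : ℝ) * Complex.I : ℂ)
      = (-2 * Real.pi * b * w : ℝ) * Complex.I + (-2 * Real.pi * u * (c * w) : ℝ) * Complex.I := by
    push_cast
    ring
  rw [this, Complex.exp_add]
  ring

theorem integrable_comp_affine (c b : ℝ) (hc : c ≠ 0) {f : ℝ → ℂ} (hf : Integrable f) :
    Integrable fun x => f (c⁻¹ * (x - b)) :=
  (hf.comp_mul_left' (inv_ne_zero hc)).comp_sub_right b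

theorem affineUnitary_schwartz_ae (c b : ℝ) (hc : c ≠ 0) (f : 𝓢(ℝ, ℂ)) :
    affineUnitary c b hc (f.toLp 2) =ᵐ[volume]
      fun x => ((Real.sqrt |c|)⁻¹ : ℂ) * f (c⁻¹ * (x - b)) := by
  filter_upwards [affineUnitary_ae c b hc (f.toLp 2),
    (quasi_affine c b hc).ae_eq_comp (f.coeFn_toLp 2 volume)] with x h1 h2
  rw [h1]
  exact congrArg _ h2

/-- Both sides are continuous in ψ, so it suffices to substitute variables in the Fourier integral
of a Schwartz function. -/
theorem fourierTransform_affineUnitary (c b : ℝ) (hc : c ≠ 0) (ψ : OneMode) :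
    Lp.fourierTransformₗᵢ ℝ ℂ (affineUnitary c b hc ψ)
      = phaseOp (-2 * Real.pi * b)
          (affineUnitary c⁻¹ 0 (inv_ne_zero hc) (Lp.fourierTransformₗᵢ ℝ ℂ ψ)) := by
  refine DenseRange.induction_on
    (p := fun ψ : OneMode => Lp.fourierTransformₗᵢ ℝ ℂ (affineUnitary c b hc ψ)
      = phaseOp (-2 * Real.pi * b)
          (affineUnitary c⁻¹ 0 (inv_ne_zero hc) (Lp.fourierTransformₗᵢ ℝ ℂ ψ)))
    (SchwartzMap.denseRange_toLpCLM (p := 2) (F := ℂ) (E := ℝ) (μ := volume)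
      ENNReal.ofNat_ne_top) ψ ?_ ?_
  · exact isClosed_eq (by fun_prop) (by fun_prop)
  intro f
  change Lp.fourierTransformₗᵢ ℝ ℂ (affineUnitary c b hc (f.toLp 2))
      = phaseOp (-2 * Real.pi * b)
          (affineUnitary c⁻¹ 0 (inv_ne_zero hc) (Lp.fourierTransformₗᵢ ℝ ℂ (f.toLp 2)))
  have hF : Lp.fourierTransformₗᵢ ℝ ℂ (f.toLp 2) = (𝓕 f).toLp 2 := SchwartzMap.toLp_fourier_eq f
  have hae := affineUnitary_schwartz_ae c b hc f
  have hm : MemLp (fun x => ((Real.sqrt |c|)⁻¹ : ℂ) * f (c⁻¹ * (x - b))) 2 :=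
    (memLp_congr_ae hae).mp (Lp.memLp _)
  have hL : affineUnitary c b hc (f.toLp 2) = hm.toLp :=
    Lp.ext (hae.trans hm.coeFn_toLp.symm)
  rw [hF, hL]
  apply Lp.ext
  filter_upwards [fourierTransform_toLp_ae_eq
      ((integrable_comp_affine c b hc f.integrable).const_mul _) hm,
    phaseOp_ae (-2 * Real.pi * b) (affineUnitary c⁻¹ 0 (inv_ne_zero hc) ((𝓕 f).toLp 2)),
    affineUnitary_schwartz_ae c⁻¹ 0 (inv_ne_zero hc) (𝓕 f)] with w h1 h2 h3
  rw [h1, h2, h3, fourier_comp_affine c b hc, inv_inv, sub_zero, SchwartzMap.fourier_coe]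
  have h4 : ((|c| : ℝ) : ℂ) * ((Real.sqrt |c|)⁻¹ : ℂ) = ((Real.sqrt |c⁻¹|)⁻¹ : ℂ) := by
    have : Real.sqrt |c| ≠ 0 := (Real.sqrt_pos.mpr (abs_pos.mpr hc)).ne'
    rw [abs_inv, Real.sqrt_inv, Complex.ofReal_inv, inv_inv]
    nth_rewrite 1 [← Real.mul_self_sqrt (abs_nonneg c)]
    push_cast
    rw [mul_assoc, mul_inv_cancel₀ (by exact_mod_cast this), mul_one]
  rw [h4]
  ring

theorem yRep_ae (ψ : OneMode) : yRep ψ =ᵐ[volume]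
    fun y => ((Real.sqrt Real.pi)⁻¹ : ℂ) * Lp.fourierTransformₗᵢ ℝ ℂ ψ (Real.pi⁻¹ * y) := by
  filter_upwards [affineUnitary_ae Real.pi 0 Real.pi_ne_zero (Lp.fourierTransformₗᵢ ℝ ℂ ψ)]
    with y hy
  have e : yRep ψ = affineUnitary Real.pi 0 Real.pi_ne_zero (Lp.fourierTransformₗᵢ ℝ ℂ ψ) := rfl
  rw [e, hy, abs_of_pos Real.pi_pos, sub_zero]

theorem yRep_affineUnitary_ae (c b : ℝ) (hc : c ≠ 0) (ψ : OneMode) :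
    yRep (affineUnitary c b hc ψ) =ᵐ[volume] fun y => (Real.sqrt |c| : ℂ)
      * Complex.exp ((-2 * b * y : ℝ) * Complex.I) * yRep ψ (c * y) := by
  have hq := quasi_affine Real.pi 0 Real.pi_ne_zero
  have hq' := quasi_affine c⁻¹ 0 (inv_ne_zero hc)
  filter_upwards [yRep_ae (affineUnitary c b hc ψ), hq'.ae_eq_comp (yRep_ae ψ),
    hq.ae_eq_comp (phaseOp_ae (-2 * Real.pi * b)
      (affineUnitary c⁻¹ 0 (inv_ne_zero hc) (Lp.fourierTransformₗᵢ ℝ ℂ ψ))),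
    hq.ae_eq_comp (affineUnitary_ae c⁻¹ 0 (inv_ne_zero hc) (Lp.fourierTransformₗᵢ ℝ ℂ ψ))]
    with y h1 h2 h3 h4
  simp only [Function.comp_apply, sub_zero, inv_inv] at h2 h3 h4
  rw [h1, fourierTransform_affineUnitary, h3, h4, h2, abs_inv, Real.sqrt_inv, Complex.ofReal_inv,
    inv_inv]
  have e1 : -2 * Real.pi * b * (Real.pi⁻¹ * y) = -2 * b * y := by
    have := Real.pi_ne_zero
    field_simp
  have e2 : c * (Real.pi⁻¹ * y) = Real.pi⁻¹ * (c * y) := by ring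
  rw [e1, e2]
  ring

end FourierL2

/-! ### Topology of the group and the Haar measure -/

namespace ReflAffine

instance : BorelSpace ReflAffine :=
  ⟨by
    exact (congrArg (MeasurableSpace.comap coords)
      (BorelSpace.measurable_eq (α := ZMod 2 × ℝ × ℝ))).trans borel_comap.symm⟩

/-- The coordinates `(ε, x, r)` as a homeomorphism. -/
def homeoCoords : ZMod 2 × ℝ × ℝ ≃ₜ ReflAffine where
  toFun p := ⟨p.1, p.2.1, p.2.2⟩
  invFun := coords
  left_inv _ := rfl
  right_inv _ := rfl
  continuous_toFun := continuous_induced_rng.mpr continuous_id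
  continuous_invFun := continuous_induced_dom

instance : SecondCountableTopology ReflAffine := homeoCoords.symm.secondCountableTopology

theorem continuous_eps : Continuous (eps : ReflAffine → ZMod 2) :=
  continuous_fst.comp homeoCoords.symm.continuous

theorem continuous_x : Continuous (x : ReflAffine → ℝ) :=
  continuous_fst.comp (continuous_snd.comp homeoCoords.symm.continuous)

theorem continuous_r : Continuous (r : ReflAffine → ℝ) :=
  continuous_snd.comp (continuous_snd.comp homeoCoords.symm.continuous)

theorem continuous_sgn : Continuous sgn := continuous_of_discreteTopology

theorem lintegral_leftHaar {f : ReflAffine → ℝ≥0∞} (hf : Measurable f) :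
    ∫⁻ g, f g ∂leftHaar
      = ∑ e : ZMod 2, ∫⁻ r : ℝ, ENNReal.ofReal (Real.exp (-r)) * ∫⁻ x : ℝ, f ⟨e, x, r⟩ := by
  have hm : Measurable fun p : ZMod 2 × ℝ × ℝ => (⟨p.1, p.2.1, p.2.2⟩ : ReflAffine) :=
    homeoCoords.continuous.measurable
  have hf' : Measurable fun p : ZMod 2 × ℝ × ℝ => f ⟨p.1, p.2.1, p.2.2⟩ := hf.comp hm
  rw [leftHaar, lintegral_map hf hm, lintegral_prod _ hf'.aemeasurable, lintegral_count, tsum_fintype]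
  refine Finset.sum_congr rfl fun e _ => ?_
  have he : Measurable fun p : ℝ × ℝ => f ⟨e, p.1, p.2⟩ := hf'.comp measurable_prodMk_left
  rw [lintegral_prod_symm _ he.aemeasurable, lintegral_withDensity_eq_lintegral_mul _
    (by fun_prop) he.lintegral_prod_left']
  rfl

theorem continuous_mul_left (g : ReflAffine) : Continuous (g * ·) := by
  refine continuous_induced_rng.mpr ?_
  change Continuous fun h : ReflAffine =>
    (g.eps + h.eps, sgn h.eps * g.x + Real.exp g.r * h.x, g.r + h.r)
  have := continuous_sgn.comp continuous_eps
  have h1 := continuous_eps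
  have h2 := continuous_x
  have h3 := continuous_r
  simp only [Function.comp_def] at this
  fun_prop

/-- Left translation by g is affine in x with slope e^{g.r}, which yields a factor e^{-g.r}. The
shift r ↦ g.r + r absorbs it into e^{-r}, and ε is merely reindexed. -/
instance : leftHaar.IsMulLeftInvariant := by
  refine ⟨fun g => Measure.ext_of_lintegral _ fun f hf => ?_⟩
  have hg := (continuous_mul_left g).measurable
  rw [lintegral_map hf hg, lintegral_leftHaar hf, lintegral_leftHaar (f := fun h => f (g * h)) (hf.comp hg)]
  refine Eq.trans (Finset.sum_congr rfl fun e _ => ?_) (Equiv.sum_comp (Equiv.addLeft g.eps) fun e =>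
    ∫⁻ r : ℝ, ENNReal.ofReal (Real.exp (-r)) * ∫⁻ x : ℝ, f ⟨e, x, r⟩)
  have hx : ∀ r : ℝ, ∫⁻ x : ℝ, f (g * ⟨e, x, r⟩)
      = ENNReal.ofReal (Real.exp (-g.r)) * ∫⁻ x : ℝ, f ⟨g.eps + e, x, g.r + r⟩ := fun r => by
    let F : ℝ → ℝ≥0∞ := fun x => f ⟨g.eps + e, x, g.r + r⟩
    have hF : Measurable F :=
      (hf.comp homeoCoords.continuous.measurable).comp (f := fun x : ℝ => (g.eps + e, x, g.r + r))
        (by fun_prop)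
    change ∫⁻ x : ℝ, F (sgn e * g.x + Real.exp g.r * x) = _
    have h1 : ∫⁻ x : ℝ, F (sgn e * g.x + Real.exp g.r * x)
        = ∫⁻ y, F (sgn e * g.x + y) ∂(volume.map fun x : ℝ => Real.exp g.r * x) :=
      (lintegral_map (f := fun y => F (sgn e * g.x + y)) (by fun_prop) (by fun_prop)).symm
    rw [h1, Real.map_volume_mul_left (Real.exp_ne_zero _), lintegral_smul_measure,
      lintegral_add_left_eq_self, abs_of_pos (by positivity), Real.exp_neg, smul_eq_mul]
  simp only [hx, Equiv.coe_addLeft]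
  conv_rhs => rw [← lintegral_add_left_eq_self _ g.r]
  refine lintegral_congr fun r => ?_
  rw [← mul_assoc, ← ENNReal.ofReal_mul (by positivity), ← Real.exp_add]
  congr 3
  ring

instance : leftHaar.IsHaarMeasure := by
  have : IsLocallyFiniteMeasure
      ((volume : Measure ℝ).withDensity fun r => ENNReal.ofReal (Real.exp (-r))) :=
    IsLocallyFiniteMeasure.withDensity_ofReal (by fun_prop)
  have : Measure.IsOpenPosMeasure
      ((volume : Measure ℝ).withDensity fun r => ENNReal.ofReal (Real.exp (-r))) :=
    (withDensity_absolutelyContinuous' (by fun_prop)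
      (by filter_upwards with r; simp [Real.exp_pos])).isOpenPosMeasure
  have h1 : IsFiniteMeasureOnCompacts leftHaar := Measure.IsFiniteMeasureOnCompacts.map _ homeoCoords
  have h2 : leftHaar.IsOpenPosMeasure :=
    homeoCoords.continuous.isOpenPosMeasure_map homeoCoords.surjective
  exact {}

end ReflAffine

/-! ### The representation: multiplicativity and strong continuity -/

theorem affineUnitary_mul (c b c' b' : ℝ) (hc : c ≠ 0) (hc' : c' ≠ 0) :
    affineUnitary c b hc * affineUnitary c' b' hc'
      = affineUnitary (c * c') (c * b' + b) (mul_ne_zero hc hc') := by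
  refine LinearIsometryEquiv.ext fun ψ => Lp.ext ?_
  filter_upwards [affineUnitary_ae c b hc (affineUnitary c' b' hc' ψ),
    (quasi_affine c b hc).ae_eq_comp (affineUnitary_ae c' b' hc' ψ),
    affineUnitary_ae (c * c') (c * b' + b) (mul_ne_zero hc hc') ψ] with x h1 h2 h3
  simp only [Function.comp_apply] at h2
  rw [LinearIsometryEquiv.coe_mul, Function.comp_apply, h1, h2, h3, abs_mul, Real.sqrt_mul (abs_nonneg c)]
  have : c'⁻¹ * (c⁻¹ * (x - b) - b') = (c * c')⁻¹ * (x - (c * b' + b)) := by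
    field_simp
    ring
  rw [this]
  push_cast
  rw [mul_inv]
  ring

theorem affineUnitary_one : affineUnitary 1 0 one_ne_zero = 1 := by
  refine LinearIsometryEquiv.ext fun ψ => Lp.ext ?_
  filter_upwards [affineUnitary_ae 1 0 one_ne_zero ψ] with x h1
  rw [h1]
  simp

theorem affineUnitary_congr {c b c' b' : ℝ} (hc : c ≠ 0) (h : c = c') (h' : b = b') :
    affineUnitary c b hc = affineUnitary c' b' (h ▸ hc) := by
  subst h h'
  rfl

namespace ReflAffine

theorem sgn_ne_zero (e : ZMod 2) : sgn e ≠ 0 := fun h => by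
  have := sgn_mul_self e
  simp [h] at this

theorem abs_sgn (e : ZMod 2) : |sgn e| = 1 := by simp [sgn]

theorem scale_ne_zero (e : ZMod 2) (r : ℝ) : sgn e * Real.exp r ≠ 0 :=
  mul_ne_zero (sgn_ne_zero e) (Real.exp_ne_zero r)

end ReflAffine

open ReflAffine

theorem parityOp_pow (e : ZMod 2) : parityOp ^ e.val = affineUnitary (sgn e) 0 (sgn_ne_zero e) := by
  fin_cases e
  · change parityOp ^ 0 = _
    rw [pow_zero, ← affineUnitary_one]
    exact affineUnitary_congr _ sgn_zero.symm rfl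
  · change parityOp ^ 1 = _
    rw [pow_one]
    exact affineUnitary_congr _ (by simp [sgn, ZMod.val]) rfl

theorem reflAffineRep_eq (g : ReflAffine) :
    reflAffineRep g
      = affineUnitary (sgn g.eps * Real.exp g.r) (sgn g.eps * g.x) (scale_ne_zero _ _) := by
  rw [reflAffineRep, parityOp_pow, displacementOp, squeezeOp, affineUnitary_mul, affineUnitary_mul]
  exact affineUnitary_congr _ (by ring) (by ring)

theorem reflAffineRep_mul (g h : ReflAffine) :
    reflAffineRep (g * h) = reflAffineRep g * reflAffineRep h := by
  rw [reflAffineRep_eq, reflAffineRep_eq, reflAffineRep_eq, affineUnitary_mul]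
  refine affineUnitary_congr _ ?_ ?_
  · simp only [mul_def, sgn_add, Real.exp_add]
    ring
  · simp only [mul_def, sgn_add]
    linear_combination (sgn g.eps * g.x) * sgn_mul_self h.eps

open SchwartzMap in
-- Dominated convergence: a Schwartz function is bounded by some C, so C|φ| dominates the integrand
-- uniformly in g.
theorem continuous_inner_reflAffineRep_schwartz (φ : OneMode) (hφ : Integrable φ)
    (f : 𝓢(ℝ, ℂ)) :
    Continuous fun g => ⟪φ, reflAffineRep g (f.toLp 2)⟫_ℂ := by
  obtain ⟨C, hC⟩ : ∃ C, ∀ x, ‖f x‖ ≤ C := by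
    obtain ⟨C, hC⟩ := f.decay 0 0
    exact ⟨C, fun x => by simpa using hC.2 x⟩
  have h1 : ∀ g : ReflAffine, ⟪φ, reflAffineRep g (f.toLp 2)⟫_ℂ
      = ((Real.sqrt (Real.exp g.r))⁻¹ : ℂ) * ∫ x, (starRingEnd ℂ) (φ x)
        * f ((sgn g.eps * Real.exp g.r)⁻¹ * (x - sgn g.eps * g.x)) := fun g => by
    rw [← integral_const_mul, reflAffineRep_eq, L2.inner_def]
    refine integral_congr_ae ?_
    filter_upwards [affineUnitary_schwartz_ae (sgn g.eps * Real.exp g.r) (sgn g.eps * g.x)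
      (scale_ne_zero _ _) f] with x hx
    rw [hx, abs_mul, abs_sgn, one_mul, Real.abs_exp, RCLike.inner_apply]
    ring
  have c1 : Continuous fun g : ReflAffine => sgn g.eps := continuous_sgn.comp continuous_eps
  have c2 := continuous_x
  have c3 := continuous_r
  simp only [h1]
  refine Continuous.mul ?_ ?_
  · have : ∀ g : ReflAffine, (Real.sqrt (Real.exp g.r) : ℂ) ≠ 0 := fun g => by
      exact_mod_cast (Real.sqrt_pos.mpr (Real.exp_pos _)).ne'
    exact Continuous.inv₀ (by fun_prop) this
  · refine continuous_of_dominated (bound := fun x => ‖φ x‖ * C) (fun g => ?_) (fun g => ?_)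
      (hφ.norm.mul_const C) ?_
    · exact AEStronglyMeasurable.mul (by fun_prop)
        (f.continuous.comp (by fun_prop)).aestronglyMeasurable
    · filter_upwards with x
      rw [norm_mul, RCLike.norm_conj]
      gcongr
      exact hC _
    · filter_upwards with x
      refine continuous_const.mul (f.continuous.comp (Continuous.mul ?_ (by fun_prop)))
      exact Continuous.inv₀ (by fun_prop) fun g => scale_ne_zero _ _

open SchwartzMap in
-- By unitarity ‖U_g f - U_{g₀} f‖² = 2‖f‖² - 2 Re⟨U_{g₀}f, U_g f⟩. Weak continuity tested on the
-- integrable vector U_{g₀}f therefore gives strong continuity at g₀.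
theorem continuous_reflAffineRep_schwartz (f : 𝓢(ℝ, ℂ)) :
    Continuous fun g => reflAffineRep g (f.toLp 2) := by
  refine continuous_iff_continuousAt.mpr fun g₀ => ?_
  have hint : Integrable (reflAffineRep g₀ (f.toLp 2)) := by
    rw [reflAffineRep_eq]
    exact ((integrable_comp_affine _ _ (scale_ne_zero _ _) f.integrable).const_mul _).congr
      (affineUnitary_schwartz_ae _ _ (scale_ne_zero _ _) f).symm
  have h1 := (continuous_inner_reflAffineRep_schwartz _ hint f).tendsto g₀
  rw [ContinuousAt, tendsto_iff_norm_sub_tendsto_zero]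
  have h2 : ∀ g, ‖reflAffineRep g (f.toLp 2) - reflAffineRep g₀ (f.toLp 2)‖
      = Real.sqrt (2 * ‖f.toLp 2 volume‖ ^ 2
        - 2 * (⟪reflAffineRep g₀ (f.toLp 2), reflAffineRep g (f.toLp 2)⟫_ℂ).re) := fun g => by
    rw [← Real.sqrt_sq (norm_nonneg (_ - _)), @norm_sub_sq ℂ, LinearIsometryEquiv.norm_map,
      LinearIsometryEquiv.norm_map, inner_re_symm]
    congr 1
    simp only [RCLike.re_to_complex]
    ring
  simp only [h2]
  have h3 := ((((Complex.continuous_re.tendsto _).comp h1).const_mul 2).const_sub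
    (2 * ‖f.toLp 2 volume‖ ^ 2)).sqrt
  have h4 : 2 * ‖f.toLp 2 volume‖ ^ 2
      - 2 * (⟪reflAffineRep g₀ (f.toLp 2), reflAffineRep g₀ (f.toLp 2)⟫_ℂ).re = 0 := by
    have := @inner_self_eq_norm_sq ℂ _ _ _ _ (reflAffineRep g₀ (f.toLp 2))
    rw [LinearIsometryEquiv.norm_map, RCLike.re_to_complex] at this
    rw [this, sub_self]
  rw [h4, Real.sqrt_zero] at h3
  exact h3

theorem continuous_reflAffineRep (v : OneMode) : Continuous fun g => reflAffineRep g v := by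
  refine DenseRange.induction_on (p := fun v : OneMode => Continuous fun g => reflAffineRep g v)
    (SchwartzMap.denseRange_toLpCLM (p := 2) (F := ℂ) (E := ℝ) (μ := volume)
      ENNReal.ofNat_ne_top) v ?_ ?_
  -- All U_g are isometries, so an approximation of v by w is uniform in g, and uniform limits
  -- preserve continuity.
  · refine isClosed_of_closure_subset fun v hv => ?_
    refine continuous_of_uniform_approx_of_continuous fun u hu => ?_
    obtain ⟨ε, hε, hεu⟩ := Metric.mem_uniformity_dist.mp hu
    obtain ⟨w, hw, hd⟩ := Metric.mem_closure_iff.mp hv ε hε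
    exact ⟨_, hw, fun g => hεu (by rwa [LinearIsometryEquiv.dist_map])⟩
  · intro f
    simpa only [SchwartzMap.toLpCLM_apply] using continuous_reflAffineRep_schwartz f

theorem isUnitaryRep_reflAffineRep : IsUnitaryRep reflAffineRep :=
  ⟨reflAffineRep_mul, continuous_reflAffineRep⟩

/-! ### The supremum of the likelihood -/

section Optimality

variable {H : Type} [NormedAddCommGroup H] [InnerProductSpace ℂ H] [CompleteSpace H]
variable {G : Type} [Group G] [MeasurableSpace G]
variable {μ : Measure G} {U : G → H ≃ₗᵢ[ℂ] H} {R : H →ₗ.[ℂ] H}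

/-- The orthogonal complement of the range of a self-adjoint operator is its kernel. -/
theorem IsSelfAdjoint.dense_range_of_injective (hR : IsSelfAdjoint R)
    (hinj : ∀ ψ : R.domain, R ψ = 0 → (ψ : H) = 0) :
    Dense (LinearMap.range R.toFun : Set H) := by
  rw [Submodule.dense_iff_topologicalClosure_eq_top, Submodule.topologicalClosure_eq_top_iff,
    Submodule.eq_bot_iff]
  intro w hw
  have h1 : (w, (0 : H)) ∈ R.graph := hR.mem_graph_of_forall_inner fun x => by
    rw [inner_zero_left]
    exact (Submodule.inner_left_of_mem_orthogonal (LinearMap.mem_range_self R.toFun x) hw).symm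
  obtain ⟨v, rfl, hv⟩ := (LinearPMap.mem_graph_iff _).mp h1
  exact hinj v hv

/-- An upper bound u satisfies |⟨ρ, ζ⟩|² ≤ u‖ρ‖² for ρ = Rη, by testing the seed of η/‖Rη‖. This
condition is closed and the range is dense, so it holds at ρ = ζ, even when ζ is not in the range.
-/
theorem HasOrthogonality.isLUB_probDensity [TopologicalSpace.SeparableSpace H] [Nontrivial H]
    (h : HasOrthogonality μ U R) (hR : IsSelfAdjoint R)
    (hinj : ∀ ψ : R.domain, R ψ = 0 → (ψ : H) = 0) {ψ ζ : H} (hζ0 : ζ ≠ 0)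
    (hζ : ∀ v : R.domain, ⟪(v : H), ψ⟫_ℂ = ⟪R v, ζ⟫_ℂ) (g : G) :
    IsLUB {l : ℝ | ∃ ξ : H →L[ℂ] H, IsCovariantSeed μ U ξ ∧ l = probDensity U ξ ψ g g}
      (‖ζ‖ ^ 2) := by
  constructor
  · rintro l ⟨ξ, hξ, rfl⟩
    exact h.probDensity_le hζ hξ g
  · intro u hu
    have hcl : IsClosed {ρ : H | ‖⟪ρ, ζ⟫_ℂ‖ ^ 2 ≤ u * ‖ρ‖ ^ 2} :=
      isClosed_le (by fun_prop) (by fun_prop)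
    have hsub : (LinearMap.range R.toFun : Set H) ⊆ {ρ : H | ‖⟪ρ, ζ⟫_ℂ‖ ^ 2 ≤ u * ‖ρ‖ ^ 2} := by
      rintro _ ⟨η, rfl⟩
      change ‖⟪R η, ζ⟫_ℂ‖ ^ 2 ≤ u * ‖R η‖ ^ 2
      by_cases h0 : R η = 0
      · simp [h0]
      have hpos : 0 < ‖R η‖ := norm_pos_iff.mpr h0
      have h1 := hu ⟨_, h.isCovariantSeed_rankOne (((‖R η‖⁻¹ : ℝ) : ℂ) • η) (by
        rw [R.map_smul, norm_smul, Complex.norm_real, norm_inv, norm_norm,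
          inv_mul_cancel₀ hpos.ne']), rfl⟩
      rw [probDensity_rankOne_self, hζ, R.map_smul, inner_smul_left, Complex.conj_ofReal, norm_mul,
        Complex.norm_real, norm_inv, norm_norm, mul_pow, inv_pow, inv_mul_le_iff₀ (by positivity),
        mul_comm] at h1
      exact h1
    have hmem := hcl.closure_subset_iff.mpr hsub (hR.dense_range_of_injective hinj ζ)
    have hpos : 0 < ‖ζ‖ ^ 2 := by positivity
    have h2 : ‖⟪ζ, ζ⟫_ℂ‖ = ‖ζ‖ ^ 2 := by
      rw [inner_self_eq_norm_sq_to_K, norm_pow, RCLike.norm_ofReal, abs_norm]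
    rw [Set.mem_ofPred_eq, h2, sq (‖ζ‖ ^ 2)] at hmem
    exact le_of_mul_le_mul_right hmem hpos

end Optimality

/-! ### Functions of Y as self-adjoint operators -/

section MultiplicationOperators

theorem lintegral_enorm_sq (v : OneMode) : ∫⁻ y, ‖v y‖ₑ ^ 2 = ‖v‖ₑ ^ 2 := by
  rw [← eLpNorm_two_sq, Lp.enorm_def]

theorem mem_graph_funY {f : ℝ → ℝ} {v w : OneMode} :
    (v, w) ∈ (funY f).graph ↔ yRep w =ᵐ[volume] fun y => (f y : ℂ) * yRep v y := by
  rw [LinearPMap.mem_graph_iff]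
  constructor
  · rintro ⟨x, rfl, rfl⟩
    exact yRep_funY_ae x
  · intro h
    have hv : v ∈ (funY f).domain := (memLp_congr_ae h).mp (Lp.memLp _)
    refine ⟨⟨v, hv⟩, rfl, yRep.injective (Lp.ext ?_)⟩
    exact (yRep_funY_ae ⟨v, hv⟩).trans h.symm

theorem sqNormOrTop_funY (f : ℝ → ℝ) (hf : Measurable f) (v : OneMode) :
    sqNormOrTop (funY f) v = ∫⁻ y, ENNReal.ofReal (f y ^ 2) * ‖yRep v y‖ₑ ^ 2 := by
  have e : ∫⁻ y, ENNReal.ofReal (f y ^ 2) * ‖yRep v y‖ₑ ^ 2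
      = eLpNorm (fun y => (f y : ℂ) * yRep v y) 2 volume ^ 2 := by
    rw [eLpNorm_two_sq]
    refine lintegral_congr fun y => ?_
    rw [enorm_mul, mul_pow, ← ofReal_norm (f y : ℂ), Complex.norm_real,
      ← ENNReal.ofReal_pow (norm_nonneg _), Real.norm_eq_abs, sq_abs]
  rw [e]
  by_cases hv : v ∈ (funY f).domain
  · rw [sqNormOrTop_of_mem hv, ← eLpNorm_congr_ae (yRep_funY_ae ⟨v, hv⟩), ← Lp.enorm_def,
      ← ofReal_norm, ← ofReal_norm, yRep.norm_map]
  · rw [sqNormOrTop, dif_neg hv]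
    by_contra hne
    refine hv (mem_funY_domain.mpr ⟨?_, lt_top_iff_ne_top.mpr fun ht => hne (by rw [ht]; rfl)⟩)
    exact (Complex.measurable_ofReal.comp hf).aestronglyMeasurable.mul (Lp.aestronglyMeasurable _)

theorem inner_eq_integral_yRep (v w : OneMode) :
    ⟪v, w⟫_ℂ = ∫ y, ⟪yRep v y, yRep w y⟫_ℂ := by
  rw [← yRep.inner_map_map, L2.inner_def]

theorem inner_congr_yRep {v w v' w' : OneMode}
    (h : ∀ᵐ y, ⟪yRep v y, yRep w y⟫_ℂ = ⟪yRep v' y, yRep w' y⟫_ℂ) :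
    ⟪v, w⟫_ℂ = ⟪v', w'⟫_ℂ := by
  rw [inner_eq_integral_yRep, inner_eq_integral_yRep]
  exact integral_congr_ae h

theorem funY_inner_comm {f : ℝ → ℝ} (v w : (funY f).domain) :
    ⟪funY f v, (w : OneMode)⟫_ℂ = ⟪(v : OneMode), funY f w⟫_ℂ := by
  refine inner_congr_yRep ?_
  filter_upwards [yRep_funY_ae v, yRep_funY_ae w] with y h1 h2
  rw [h1, h2, RCLike.inner_apply, RCLike.inner_apply, map_mul, Complex.conj_ofReal]
  ring

/-- The test vector is the difference of the two sides truncated to |f| ≤ n, where multiplication by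
f is bounded. The hypothesis makes its norm zero, and n is arbitrary. -/
theorem yRep_ae_eq_of_forall_inner {f : ℝ → ℝ} (hf : Measurable f) {v w : OneMode}
    (h : ∀ x : (funY f).domain, ⟪w, (x : OneMode)⟫_ℂ = ⟪v, funY f x⟫_ℂ) :
    yRep w =ᵐ[volume] fun y => (f y : ℂ) * yRep v y := by
  have hfm : Measurable fun y => (f y : ℂ) := Complex.measurable_ofReal.comp hf
  have key : ∀ n : ℕ, ∀ᵐ y, |f y| ≤ n → yRep w y = (f y : ℂ) * yRep v y := fun n => by
    let s : Set ℝ := {y | |f y| ≤ n}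
    have hs : MeasurableSet s := measurableSet_le hf.abs measurable_const
    let d : ℝ → ℂ := fun y => yRep w y - (f y : ℂ) * yRep v y
    have hb : ∀ k : OneMode, MemLp (s.indicator fun y => (f y : ℂ) * k y) 2 volume := fun k => by
      refine MemLp.of_le_mul (c := n) (Lp.memLp k)
        ((hfm.aestronglyMeasurable.mul (Lp.aestronglyMeasurable k)).indicator hs) ?_
      filter_upwards with y
      by_cases hy : y ∈ s
      · rw [Set.indicator_of_mem hy, norm_mul, Complex.norm_real, Real.norm_eq_abs]
        gcongr
        exact hy
      · rw [Set.indicator_of_notMem hy, norm_zero]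
        positivity
    have hd : MemLp (s.indicator d) 2 volume := by
      have := ((Lp.memLp (yRep w)).indicator hs).sub (hb (yRep v))
      rwa [← Set.indicator_sub'] at this
    let x : OneMode := yRep.symm hd.toLp
    have hx : yRep x =ᵐ[volume] s.indicator d := by
      rw [yRep.apply_symm_apply]
      exact hd.coeFn_toLp
    have hxd : x ∈ (funY f).domain := by
      refine mem_funY_domain.mpr ((memLp_congr_ae ?_).mp (hb (yRep x)))
      filter_upwards [hx] with y hy
      by_cases hys : y ∈ s
      · rw [Set.indicator_of_mem hys]
      · rw [Set.indicator_of_notMem hys, hy, Set.indicator_of_notMem hys, mul_zero]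
    have h1 := h ⟨x, hxd⟩
    rw [inner_eq_integral_yRep, inner_eq_integral_yRep, ← sub_eq_zero,
      ← integral_sub (L2.integrable_inner _ _) (L2.integrable_inner _ _)] at h1
    have h2 : ∫ y, ((‖s.indicator d y‖ ^ 2 : ℝ) : ℂ) = 0 := by
      rw [← h1]
      refine integral_congr_ae ?_
      filter_upwards [hx, yRep_funY_ae ⟨x, hxd⟩] with y h3 h4
      rw [h4, h3, RCLike.inner_apply, RCLike.inner_apply]
      by_cases hys : y ∈ s
      · rw [Set.indicator_of_mem hys, ← Complex.normSq_eq_norm_sq, ← Complex.mul_conj]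
        simp only [d, map_sub, map_mul, Complex.conj_ofReal]
        ring
      · rw [Set.indicator_of_notMem hys]
        simp
    rw [integral_complex_ofReal, Complex.ofReal_eq_zero,
      integral_eq_zero_iff_of_nonneg (fun y => sq_nonneg _) ((memLp_two_iff_integrable_sq_norm hd.1).mp hd)] at h2
    filter_upwards [h2] with y hy hys
    have : s.indicator d y = 0 := by simpa using hy
    rw [Set.indicator_of_mem (show y ∈ s from hys)] at this
    exact sub_eq_zero.mp this
  filter_upwards [ae_all_iff.mpr key] with y hy
  obtain ⟨n, hn⟩ := exists_nat_ge |f y|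
  exact hy n hn

theorem isSelfAdjoint_funY {f : ℝ → ℝ} (hf : Measurable f) : IsSelfAdjoint (funY f) := by
  have hdense : Dense ((funY f).domain : Set OneMode) := by
    rw [Submodule.dense_iff_topologicalClosure_eq_top, Submodule.topologicalClosure_eq_top_iff,
      Submodule.eq_bot_iff]
    intro w hw
    -- A vector orthogonal to the domain satisfies the adjoint relation with v = 0, hence vanishes.
    have h1 := yRep_ae_eq_of_forall_inner hf (v := 0) (w := w) fun x => by
      rw [inner_zero_left]
      exact Submodule.inner_left_of_mem_orthogonal x.2 hw
    refine yRep.injective (Lp.ext ?_)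
    rw [map_zero]
    filter_upwards [h1, Lp.coeFn_zero ℂ 2 (volume : Measure ℝ)] with y h2 h3
    rw [h2, map_zero, h3, Pi.zero_apply, mul_zero]
  rw [LinearPMap.isSelfAdjoint_def]
  refine le_antisymm (LinearPMap.le_of_le_graph ?_) ?_
  · rintro ⟨v, w⟩ hvw
    obtain ⟨v, rfl, rfl⟩ := (LinearPMap.mem_graph_iff _).mp hvw
    exact mem_graph_funY.mpr (yRep_ae_eq_of_forall_inner hf fun x =>
      LinearPMap.adjoint_isFormalAdjoint hdense v x)
  · exact LinearPMap.IsFormalAdjoint.le_adjoint hdense fun x y => funY_inner_comm x y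

theorem isPositiveSelfAdjoint_funY {f : ℝ → ℝ} (hf : Measurable f) (h0 : ∀ y, 0 ≤ f y) :
    IsPositiveSelfAdjoint (funY f) := by
  refine ⟨isSelfAdjoint_funY hf, fun v => ?_⟩
  have h1 : ⟪(v : OneMode), funY f v⟫_ℂ
      = ∫ y, ((f y * ‖yRep (v : OneMode) y‖ ^ 2 : ℝ) : ℂ) := by
    rw [inner_eq_integral_yRep]
    refine integral_congr_ae ?_
    filter_upwards [yRep_funY_ae v] with y hy
    rw [hy, RCLike.inner_apply, mul_assoc, Complex.mul_conj, Complex.normSq_eq_norm_sq]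
    push_cast
    rfl
  rw [h1, integral_complex_ofReal, Complex.ofReal_re]
  exact integral_nonneg fun y => mul_nonneg (h0 y) (sq_nonneg _)

theorem isSqrtOf_funY {f g : ℝ → ℝ} (hg : Measurable g) (h0 : ∀ y, 0 ≤ g y)
    (hfg : ∀ y, g y * g y = f y) : IsSqrtOf (funY g) (funY f) := by
  refine ⟨isPositiveSelfAdjoint_funY hg h0, fun v w => ?_⟩
  have hgm : Measurable fun y => (g y : ℂ) := Complex.measurable_ofReal.comp hg
  constructor
  · intro hvw
    have h1 := mem_graph_funY.mp hvw
    -- Since g ≤ 1 + g², a vector in the domain of g² is in that of g.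
    have hm : MemLp (fun y => (g y : ℂ) * yRep v y) 2 volume := by
      refine MemLp.of_le ((Lp.memLp (yRep v)).norm.add (Lp.memLp (yRep w)).norm)
        (hgm.aestronglyMeasurable.mul (Lp.aestronglyMeasurable _)) ?_
      filter_upwards [h1] with y hy
      rw [Pi.add_apply, hy, norm_mul, norm_mul, Complex.norm_real, Complex.norm_real, ← hfg,
        norm_mul, Real.norm_of_nonneg (h0 y), Real.norm_of_nonneg
        (add_nonneg (norm_nonneg _) (mul_nonneg (mul_nonneg (h0 y) (h0 y)) (norm_nonneg _)))]
      nlinarith [norm_nonneg (yRep v y), mul_nonneg (sq_nonneg (g y - 1)) (norm_nonneg (yRep v y)),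
        mul_nonneg (sq_nonneg (g y)) (norm_nonneg (yRep v y))]
    refine ⟨yRep.symm hm.toLp, mem_graph_funY.mpr ?_, mem_graph_funY.mpr ?_⟩
    · rw [yRep.apply_symm_apply]
      exact hm.coeFn_toLp
    · rw [yRep.apply_symm_apply]
      filter_upwards [h1, hm.coeFn_toLp] with y h2 h3
      rw [h2, h3, ← hfg]
      push_cast
      ring
  · rintro ⟨u, hu, hw⟩
    refine mem_graph_funY.mpr ?_
    filter_upwards [mem_graph_funY.mp hu, mem_graph_funY.mp hw] with y h2 h3
    rw [h3, h2, ← hfg]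
    push_cast
    ring

/-- A zero of f at the null point y = 0 is harmless; in particular the default value π/|0| = 0 plays
no role. -/
theorem funY_injective {f : ℝ → ℝ} (hf : ∀ y, y ≠ 0 → f y ≠ 0) (v : (funY f).domain)
    (hv : funY f v = 0) : (v : OneMode) = 0 := by
  refine yRep.injective (Lp.ext ?_)
  have h1 := yRep_funY_ae v
  rw [hv, map_zero] at h1
  rw [map_zero]
  filter_upwards [h1, Lp.coeFn_zero ℂ 2 (volume : Measure ℝ), Measure.ae_ne volume (0 : ℝ)]
    with y h2 h3 h4
  rw [h3, Pi.zero_apply, zero_eq_mul] at h2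
  rw [h3, Pi.zero_apply]
  exact h2.resolve_left (by exact_mod_cast hf y h4)

end MultiplicationOperators

/-! ### The orthogonality relation for the affine group -/

section Orbits

open FourierTransform ReflAffine

theorem lintegral_comp_mul_left {F : ℝ → ℝ≥0∞} (hF : Measurable F) {a : ℝ} (ha : a ≠ 0) :
    ∫⁻ x, F (a * x) = ENNReal.ofReal |a⁻¹| * ∫⁻ x, F x := by
  rw [← lintegral_map hF (measurable_const_mul a), Real.map_volume_mul_left ha,
    lintegral_smul_measure, smul_eq_mul]

theorem lintegral_comp_exp (F : ℝ → ℝ≥0∞) :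
    ∫⁻ r, F (Real.exp r) = ∫⁻ z in Set.Ioi 0, ENNReal.ofReal |z|⁻¹ * F z := by
  rw [← Real.range_exp, ← Set.image_univ,
    lintegral_image_eq_lintegral_abs_deriv_mul MeasurableSet.univ
      (fun x _ => (Real.hasDerivAt_exp x).hasDerivWithinAt) Real.exp_injective.injOn,
    setLIntegral_univ]
  refine lintegral_congr fun r => ?_
  rw [← mul_assoc, ← ENNReal.ofReal_mul (abs_nonneg _),
    mul_inv_cancel₀ (abs_pos.mpr (Real.exp_ne_zero r)).ne', ENNReal.ofReal_one, one_mul]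

theorem lintegral_comp_neg_exp {F : ℝ → ℝ≥0∞} (hF : Measurable F) :
    ∫⁻ r, F (-Real.exp r) = ∫⁻ z in Set.Iio 0, ENNReal.ofReal |z|⁻¹ * F z := by
  rw [lintegral_comp_exp fun z => F (-z),
    ← (Measure.measurePreserving_neg (volume : Measure ℝ)).setLIntegral_comp_preimage
      measurableSet_Iio (f := fun z => ENNReal.ofReal |z|⁻¹ * F z) (by fun_prop)]
  simp

/-- The dilations ±e^r act simply transitively on the nonzero reals, and dr together with the sum
over signs becomes the invariant measure dz/|z|. The result does not depend on y, which makes the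
double integral factorize. -/
theorem sum_lintegral_orbit {F : ℝ → ℝ≥0∞} (hF : Measurable F) {y : ℝ} (hy : y ≠ 0) :
    ∑ e : ZMod 2, ∫⁻ r, F (sgn e * Real.exp r * y) = ∫⁻ z, ENNReal.ofReal |z|⁻¹ * F z := by
  -- The translation r ↦ r + log|y| absorbs the scale of y; its sign only exchanges the two branches
  -- below.
  have hs : ∀ c : ℝ, ∫⁻ r, F (c * Real.exp r * |y|) = ∫⁻ r, F (c * Real.exp r) := fun c => by
    rw [← lintegral_add_right_eq_self (fun r => F (c * Real.exp r)) (Real.log |y|)]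
    refine lintegral_congr fun r => ?_
    rw [Real.exp_add, Real.exp_log (abs_pos.mpr hy), mul_assoc]
  have hsum : ∑ e : ZMod 2, ∫⁻ r, F (sgn e * Real.exp r * y)
      = (∫⁻ r, F (Real.exp r * y)) + ∫⁻ r, F (-Real.exp r * y) := by
    have h1 : sgn 1 = -1 := by rw [sgn, ZMod.val_one, pow_one]
    have : ∀ f : ZMod 2 → ℝ≥0∞, ∑ e, f e = f 0 + f 1 := fun f => Fin.sum_univ_two f
    rw [this, sgn_zero, h1]
    simp
  have hpm : (∫⁻ r, F (Real.exp r * y)) + ∫⁻ r, F (-Real.exp r * y)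
      = (∫⁻ r, F (Real.exp r)) + ∫⁻ r, F (-Real.exp r) := by
    have h1 := hs 1
    have h2 := hs (-1)
    simp only [one_mul, neg_one_mul] at h1 h2
    rw [← h1, ← h2]
    rcases lt_or_gt_of_ne hy with h | h
    · rw [abs_of_neg h, add_comm]
      simp
    · rw [abs_of_pos h]
  rw [hsum, hpm, lintegral_comp_exp, lintegral_comp_neg_exp hF, add_comm,
    setLIntegral_congr Ioi_ae_eq_Ici, ← Set.compl_Iio, lintegral_add_compl _ measurableSet_Iio]

/-- The integrand of a matrix element of the representation at `x = 0`. -/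
def overlap (φ ψ : OneMode) (c y : ℝ) : ℂ := (starRingEnd ℂ) (yRep φ y) * yRep ψ (c * y)

theorem integrable_overlap (φ ψ : OneMode) {c : ℝ} (hc : c ≠ 0) :
    Integrable (overlap φ ψ c) := by
  have h1 := L2.integrable_inner (𝕜 := ℂ) (yRep φ) (affineUnitary c⁻¹ 0 (inv_ne_zero hc) (yRep ψ))
  have h2 : ((Real.sqrt |c⁻¹|) : ℂ) ≠ 0 := by
    exact_mod_cast (Real.sqrt_pos.mpr (abs_pos.mpr (inv_ne_zero hc))).ne'
  refine (h1.const_mul ((Real.sqrt |c⁻¹|) : ℂ)).congr ?_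
  filter_upwards [affineUnitary_ae c⁻¹ 0 (inv_ne_zero hc) (yRep ψ)] with y hy
  rw [hy, RCLike.inner_apply, overlap, inv_inv, sub_zero]
  linear_combination
    (yRep ψ (c * y) * (starRingEnd ℂ) (yRep φ y)) * mul_inv_cancel₀ h2

theorem inner_affineUnitary (φ ψ : OneMode) (c b : ℝ) (hc : c ≠ 0) :
    ⟪φ, affineUnitary c b hc ψ⟫_ℂ
      = (Real.sqrt |c| : ℂ) * 𝓕 (overlap φ ψ c) (Real.pi⁻¹ * b) := by
  rw [inner_eq_integral_yRep, Real.fourier_real_eq_integral_exp_smul, ← integral_const_mul]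
  refine integral_congr_ae ?_
  filter_upwards [yRep_affineUnitary_ae c b hc ψ] with y hy
  have e : -2 * Real.pi * y * (Real.pi⁻¹ * b) = -2 * b * y := by
    have := Real.pi_ne_zero
    field_simp
  rw [hy, RCLike.inner_apply, overlap, e, smul_eq_mul]
  ring

/-- Plancherel in the displacement: the Fourier variable is sx/π, whose Jacobian is the source of
the π in D = π/|Y|. -/
theorem lintegral_inner_affineUnitary (φ ψ : OneMode) (c s : ℝ) (hc : c ≠ 0) (hs : |s| = 1) :
    ∫⁻ x : ℝ, ‖⟪φ, affineUnitary c (s * x) hc ψ⟫_ℂ‖ₑ ^ 2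
      = ENNReal.ofReal |c| * (ENNReal.ofReal Real.pi *
          ∫⁻ y, ‖yRep φ y‖ₑ ^ 2 * ‖yRep ψ (c * y)‖ₑ ^ 2) := by
  have hint := integrable_overlap φ ψ hc
  have hm : Measurable fun w => ‖𝓕 (overlap φ ψ c) w‖ₑ ^ 2 :=
    (continuous_fourier_of_integrable hint).measurable.enorm.pow_const 2
  have hs0 : s ≠ 0 := fun h => by simp [h] at hs
  have h1 : ∀ x, ‖⟪φ, affineUnitary c (s * x) hc ψ⟫_ℂ‖ₑ ^ 2
      = ENNReal.ofReal |c| * ‖𝓕 (overlap φ ψ c) (Real.pi⁻¹ * s * x)‖ₑ ^ 2 := fun x => by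
    rw [inner_affineUnitary, enorm_mul, mul_pow, ← ofReal_norm (Real.sqrt |c| : ℂ),
      Complex.norm_real, ← ENNReal.ofReal_pow (norm_nonneg _), Real.norm_eq_abs, sq_abs,
      Real.sq_sqrt (abs_nonneg c), mul_assoc]
  simp only [h1]
  have hm' : Measurable fun x => ‖𝓕 (overlap φ ψ c) (Real.pi⁻¹ * s * x)‖ₑ ^ 2 :=
    hm.comp (measurable_const_mul _)
  rw [lintegral_const_mul _ hm',
    lintegral_comp_mul_left (F := fun w => ‖𝓕 (overlap φ ψ c) w‖ₑ ^ 2) hm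
      (mul_ne_zero (inv_ne_zero Real.pi_ne_zero) hs0), lintegral_fourier_sq hint]
  have h2 : |(Real.pi⁻¹ * s)⁻¹| = Real.pi := by
    rw [mul_inv, inv_inv, abs_mul, abs_inv, hs, inv_one, mul_one, abs_of_pos Real.pi_pos]
  rw [h2]
  simp only [overlap, enorm_mul, RCLike.enorm_conj, mul_pow]

theorem measurable_inner_reflAffineRep (φ ψ : OneMode) :
    Measurable fun g => ⟪φ, reflAffineRep g ψ⟫_ℂ :=
  (continuous_const.inner (continuous_reflAffineRep ψ)).measurable

/-- The square root `√(π / |Y|)` of the Duflo-Moore-Carey operator. -/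
def sqrtPiDivAbsY : OneMode →ₗ.[ℂ] OneMode := funY fun y => Real.sqrt (Real.pi / |y|)

theorem hasOrthogonality_reflAffineRep :
    HasOrthogonality leftHaar reflAffineRep sqrtPiDivAbsY := by
  refine ⟨fun φ ψ => (measurable_inner_reflAffineRep φ ψ).aestronglyMeasurable, fun φ ψ => ?_⟩
  let F : ℝ → ℝ≥0∞ := fun z => ‖yRep ψ z‖ₑ ^ 2
  have hF : Measurable F := (Lp.stronglyMeasurable (yRep ψ)).measurable.enorm.pow_const 2
  have hφ : Measurable fun y => ‖yRep φ y‖ₑ ^ 2 :=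
    (Lp.stronglyMeasurable (yRep φ)).measurable.enorm.pow_const 2
  rw [lintegral_leftHaar ((measurable_inner_reflAffineRep φ ψ).enorm.pow_const 2)]
  have h1 : ∀ (e : ZMod 2) (r : ℝ), ENNReal.ofReal (Real.exp (-r)) *
      ∫⁻ x : ℝ, ‖⟪φ, reflAffineRep ⟨e, x, r⟩ ψ⟫_ℂ‖ₑ ^ 2
      = ENNReal.ofReal Real.pi * ∫⁻ y, ‖yRep φ y‖ₑ ^ 2 * F (sgn e * Real.exp r * y) := by
    intro e r
    simp only [reflAffineRep_eq]
    have h := lintegral_inner_affineUnitary φ ψ _ (sgn e) (scale_ne_zero e r) (abs_sgn e)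
    rw [h, ← mul_assoc,
      ← ENNReal.ofReal_mul (by positivity), abs_mul, abs_sgn, one_mul, Real.abs_exp,
      ← Real.exp_add, neg_add_cancel, Real.exp_zero, ENNReal.ofReal_one, one_mul]
  have hm2 : ∀ e, Measurable fun p : ℝ × ℝ => ‖yRep φ p.2‖ₑ ^ 2 * F (sgn e * Real.exp p.1 * p.2) :=
    fun e => (hφ.comp measurable_snd).mul (hF.comp (by fun_prop))
  have h2 : ∀ e : ZMod 2, ∫⁻ r, ENNReal.ofReal Real.pi *
        ∫⁻ y, ‖yRep φ y‖ₑ ^ 2 * F (sgn e * Real.exp r * y)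
      = ENNReal.ofReal Real.pi *
        ∫⁻ y, ‖yRep φ y‖ₑ ^ 2 * ∫⁻ r, F (sgn e * Real.exp r * y) := fun e => by
    rw [lintegral_const_mul _ (hm2 e).lintegral_prod_right',
      lintegral_lintegral_swap (hm2 e).aemeasurable]
    congr 1
    have h : ∀ y, Measurable fun r => F (sgn e * Real.exp r * y) := fun y => hF.comp (by fun_prop)
    exact lintegral_congr fun y => lintegral_const_mul (‖yRep φ y‖ₑ ^ 2) (h y)
  simp only [h1, h2]
  rw [← Finset.mul_sum, ← lintegral_finsetSum]
  · simp only [← Finset.mul_sum]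
    have h3 : ∫⁻ y, ‖yRep φ y‖ₑ ^ 2 * ∑ e : ZMod 2, ∫⁻ r, F (sgn e * Real.exp r * y)
        = ∫⁻ y, ‖yRep φ y‖ₑ ^ 2 * ∫⁻ z, ENNReal.ofReal |z|⁻¹ * F z := by
      refine lintegral_congr_ae ?_
      filter_upwards [Measure.ae_ne volume (0 : ℝ)] with y hy
      rw [sum_lintegral_orbit hF hy]
    have h4 : Measurable fun z : ℝ => ENNReal.ofReal |z|⁻¹ * F z := by fun_prop
    have h5 : Measurable fun y : ℝ => Real.sqrt (Real.pi / |y|) := by fun_prop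
    rw [h3, lintegral_mul_const _ hφ, lintegral_enorm_sq, LinearIsometryEquiv.enorm_map,
      mul_left_comm, ← lintegral_const_mul _ h4, sqrtPiDivAbsY, sqNormOrTop_funY _ h5]
    congr 1
    refine lintegral_congr fun z => ?_
    rw [Real.sq_sqrt (by positivity), ← mul_assoc, ← ENNReal.ofReal_mul Real.pi_nonneg,
      div_eq_mul_inv]
  · intro e _
    have : Measurable fun p : ℝ × ℝ => F (sgn e * Real.exp p.2 * p.1) := hF.comp (by fun_prop)
    exact hφ.mul this.lintegral_prod_right'

end Orbits

/-! ### The optimal seed -/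

section Quadrature

theorem isSqrtOf_sqrtPiDivAbsY : IsSqrtOf sqrtPiDivAbsY piDivAbsY :=
  isSqrtOf_funY (by fun_prop) (fun _ => Real.sqrt_nonneg _)
    fun y => Real.mul_self_sqrt (div_nonneg Real.pi_nonneg (abs_nonneg y))

theorem isSqrtOf_sqrtAbsY : IsSqrtOf sqrtAbsY absY :=
  isSqrtOf_funY (by fun_prop) (fun _ => Real.sqrt_nonneg _)
    fun y => Real.mul_self_sqrt (abs_nonneg y)

theorem sqrtPiDivAbsY_injective (v : sqrtPiDivAbsY.domain) (hv : sqrtPiDivAbsY v = 0) :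
    (v : OneMode) = 0 :=
  funY_injective (fun _ hy => (Real.sqrt_pos.mpr (by positivity)).ne') v hv

theorem sqrtAbsY_injective (v : sqrtAbsY.domain) (hv : sqrtAbsY v = 0) : (v : OneMode) = 0 :=
  funY_injective (fun _ hy => (Real.sqrt_pos.mpr (abs_pos.mpr hy)).ne') v hv

theorem sqrt_pi_div_mul_sqrt {y : ℝ} (hy : y ≠ 0) :
    Real.sqrt (Real.pi / |y|) * Real.sqrt |y| = Real.sqrt Real.pi := by
  rw [← Real.sqrt_mul (by positivity), div_mul_cancel₀ _ (abs_pos.mpr hy).ne']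

/-- This identifies ζ = π^{-1/2}|Y|^{1/2}ψ as the weak solution of √(π/|Y|) ζ = ψ required by the
likelihood bound. -/
theorem inner_eq_inner_sqrtPiDivAbsY (ψ : sqrtAbsY.domain) (v : sqrtPiDivAbsY.domain) :
    ⟪(v : OneMode), (ψ : OneMode)⟫_ℂ
      = ⟪sqrtPiDivAbsY v, (((Real.sqrt Real.pi)⁻¹ : ℝ) : ℂ) • sqrtAbsY ψ⟫_ℂ := by
  refine inner_congr_yRep ?_
  rw [map_smul]
  have hv : yRep (sqrtPiDivAbsY v) =ᵐ[volume] _ := yRep_funY_ae v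
  have hψ : yRep (sqrtAbsY ψ) =ᵐ[volume] _ := yRep_funY_ae ψ
  filter_upwards [hv, hψ, Measure.ae_ne volume (0 : ℝ),
    Lp.coeFn_smul (((Real.sqrt Real.pi)⁻¹ : ℝ) : ℂ) (yRep (sqrtAbsY ψ))] with y h1 h2 h3 h4
  have h5 : ((Real.sqrt Real.pi)⁻¹ * (Real.sqrt (Real.pi / |y|) * Real.sqrt |y|) : ℝ) = 1 := by
    rw [sqrt_pi_div_mul_sqrt h3, inv_mul_cancel₀ (Real.sqrt_pos.mpr Real.pi_pos).ne']
  have h6 : (((Real.sqrt Real.pi)⁻¹ : ℝ) : ℂ) * ((Real.sqrt (Real.pi / |y|) : ℂ)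
      * (Real.sqrt |y| : ℂ)) = 1 := by exact_mod_cast h5
  rw [h4, Pi.smul_apply, h1, h2, RCLike.inner_apply, RCLike.inner_apply, map_mul,
    Complex.conj_ofReal, smul_eq_mul]
  linear_combination (-(yRep (ψ : OneMode) y * (starRingEnd ℂ) (yRep (v : OneMode) y))) * h6

/-- Used with u = |Y|^{1/2}ψ and w = |Y|ψ: it puts |Y|ψ into dom D^{1/2} with image √π |Y|^{1/2}ψ,
so that `optimalVec` is an admissible vector. -/
theorem mem_graph_sqrtPiDivAbsY {u w : OneMode}
    (hw : (u, w) ∈ sqrtAbsY.graph) :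
    (w, ((Real.sqrt Real.pi : ℝ) : ℂ) • u) ∈ sqrtPiDivAbsY.graph := by
  refine mem_graph_funY.mpr ?_
  rw [map_smul]
  filter_upwards [mem_graph_funY.mp hw, Measure.ae_ne volume (0 : ℝ),
    Lp.coeFn_smul ((Real.sqrt Real.pi : ℝ) : ℂ) (yRep u)] with y h1 h2 h3
  rw [h3, Pi.smul_apply, h1, smul_eq_mul, ← sqrt_pi_div_mul_sqrt h2]
  push_cast
  ring

instance : Nontrivial OneMode := by
  refine ⟨indicatorConstLp 2 (measurableSet_Icc : MeasurableSet (Set.Icc (0 : ℝ) 1)) (by simp) 1, 0,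
    fun h => ?_⟩
  have h1 := congrArg norm h
  rw [norm_indicatorConstLp (by norm_num) (by norm_num), norm_zero] at h1
  simp at h1

instance : TopologicalSpace.SeparableSpace OneMode := by
  have : Fact ((2 : ℝ≥0∞) ≠ ⊤) := ⟨by norm_num⟩
  infer_instance

theorem norm_sq_smul_sqrtAbsY (v : OneMode) :
    ‖(((Real.sqrt Real.pi)⁻¹ : ℝ) : ℂ) • v‖ ^ 2 = ‖v‖ ^ 2 / Real.pi := by
  rw [norm_smul, mul_pow, Complex.norm_real, Real.norm_eq_abs, sq_abs, inv_pow,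
    Real.sq_sqrt Real.pi_nonneg, div_eq_inv_mul]

theorem isMaxLikelihoodSeed_optimalVec (ψ : absY.domain) (hψ : ‖(ψ : OneMode)‖ = 1) :
    0 < (⟪(ψ : OneMode), absY ψ⟫_ℂ).re ∧
      IsMaxLikelihoodSeed ReflAffine.leftHaar reflAffineRep (ψ : OneMode)
        (InnerProductSpace.rankOne ℂ (optimalVec ψ) (optimalVec ψ)) ∧
      ∀ g : ReflAffine,
        probDensity reflAffineRep (InnerProductSpace.rankOne ℂ (optimalVec ψ) (optimalVec ψ))
          (ψ : OneMode) g g = (⟪(ψ : OneMode), absY ψ⟫_ℂ).re / Real.pi := by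
  obtain ⟨u, hψu, huw⟩ := (isSqrtOf_sqrtAbsY.2 (ψ : OneMode) (absY ψ)).mp
    ((LinearPMap.mem_graph_iff _).mpr ⟨ψ, rfl, rfl⟩)
  have hR := mem_graph_sqrtPiDivAbsY huw
  obtain ⟨ψ', hψ', rfl⟩ := (LinearPMap.mem_graph_iff _).mp hψu
  obtain ⟨u', hu', hw'⟩ := (LinearPMap.mem_graph_iff _).mp huw
  obtain ⟨w, hw, hRw⟩ := (LinearPMap.mem_graph_iff _).mp hR
  dsimp only at hψ' hu' hw' hw hRw
  have hm : ⟪(ψ : OneMode), absY ψ⟫_ℂ = ((‖sqrtAbsY ψ'‖ ^ 2 : ℝ) : ℂ) := by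
    rw [← hw', ← hψ', ← isSqrtOf_sqrtAbsY.1.1.inner_apply_comm, hu', inner_self_eq_norm_sq_to_K]
    norm_cast
  have hu0 : sqrtAbsY ψ' ≠ 0 := fun h => by
    rw [← hψ', sqrtAbsY_injective ψ' h, norm_zero] at hψ
    exact zero_ne_one hψ
  have hpos : 0 < ‖sqrtAbsY ψ'‖ := norm_pos_iff.mpr hu0
  have hpi := Real.pi_pos
  set m : ℝ := ‖sqrtAbsY ψ'‖ ^ 2 with hmdef
  have hm0 : 0 < m := by positivity
  have hre : (⟪(ψ : OneMode), absY ψ⟫_ℂ).re = m := by rw [hm, Complex.ofReal_re]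
  have hη : optimalVec ψ = (((((Real.sqrt (Real.pi * m))⁻¹ : ℝ) : ℂ) • w :
      sqrtPiDivAbsY.domain) : OneMode) := by
    rw [optimalVec, hre, Submodule.coe_smul, hw, Complex.ofReal_inv]
  have hseed : IsCovariantSeed ReflAffine.leftHaar reflAffineRep
      (InnerProductSpace.rankOne ℂ (optimalVec ψ) (optimalVec ψ)) := by
    rw [hη]
    refine hasOrthogonality_reflAffineRep.isCovariantSeed_rankOne _ ?_
    rw [sqrtPiDivAbsY.map_smul, hRw, norm_smul, norm_smul, Complex.norm_real, Complex.norm_real,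
      norm_inv, Real.norm_of_nonneg (Real.sqrt_nonneg _), Real.norm_of_nonneg (Real.sqrt_nonneg _),
      Real.sqrt_mul hpi.le, hmdef, Real.sqrt_sq hpos.le]
    -- With m = ⟨ψ||Y||ψ⟩ = ‖|Y|^{1/2}ψ‖², the image of η has norm √π √m / √(πm) = 1.
    exact inv_mul_cancel₀ (by positivity)
  have hval : ∀ g : ReflAffine,
      probDensity reflAffineRep (InnerProductSpace.rankOne ℂ (optimalVec ψ) (optimalVec ψ))
          (ψ : OneMode) g g = m / Real.pi := fun g => by
    rw [probDensity_rankOne_self, optimalVec, hre, inner_smul_left, ← inner_conj_symm, hm,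
      norm_mul, RCLike.norm_conj, RCLike.norm_conj, Complex.norm_real, norm_inv, Complex.norm_real,
      Real.norm_of_nonneg (Real.sqrt_nonneg _), Real.norm_of_nonneg hm0.le, mul_pow, inv_pow,
      Real.sq_sqrt (by positivity)]
    field_simp
  rw [hre]
  refine ⟨hm0, ⟨hseed, fun ξ' hξ' g => ?_⟩, hval⟩
  rw [hval g, hmdef, ← norm_sq_smul_sqrtAbsY]
  refine hasOrthogonality_reflAffineRep.probDensity_le (fun v => ?_) hξ' g
  rw [← hψ']
  exact inner_eq_inner_sqrtPiDivAbsY ψ' v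

end Quadrature

end

theorem mainTheorem7 :
    ReflAffine.leftHaar.IsHaarMeasure ∧
    IsUnitaryRep reflAffineRep ∧
    IsIrreducibleRep reflAffineRep ∧
    (∀ D : OneMode →ₗ.[ℂ] OneMode,
      IsDMCOperator ReflAffine.leftHaar reflAffineRep D ↔ D = piDivAbsY) ∧
    (∀ ψ : sqrtAbsY.domain, ‖(ψ : OneMode)‖ = 1 → ∀ g : ReflAffine,
      IsLUB {l : ℝ | ∃ ξ : OneMode →L[ℂ] OneMode,
          IsCovariantSeed ReflAffine.leftHaar reflAffineRep ξ ∧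
            l = probDensity reflAffineRep ξ (ψ : OneMode) g g}
        (‖sqrtAbsY ψ‖ ^ 2 / Real.pi)) ∧
    (∀ ψ : absY.domain, ‖(ψ : OneMode)‖ = 1 →
      0 < (⟪(ψ : OneMode), absY ψ⟫_ℂ).re ∧
      IsMaxLikelihoodSeed ReflAffine.leftHaar reflAffineRep (ψ : OneMode)
        (InnerProductSpace.rankOne ℂ (optimalVec ψ) (optimalVec ψ)) ∧
      ∀ g : ReflAffine,
        probDensity reflAffineRep (InnerProductSpace.rankOne ℂ (optimalVec ψ) (optimalVec ψ))
          (ψ : OneMode) g g = (⟪(ψ : OneMode), absY ψ⟫_ℂ).re / Real.pi) := by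
  have hO := hasOrthogonality_reflAffineRep
  refine ⟨inferInstance, isUnitaryRep_reflAffineRep, hO.isIrreducibleRep sqrtPiDivAbsY_injective,
    hO.isDMCOperator_iff
      (isPositiveSelfAdjoint_funY (by fun_prop) fun y => div_nonneg Real.pi_nonneg (abs_nonneg y))
      isSqrtOf_sqrtPiDivAbsY, fun ψ hψ g => ?_, isMaxLikelihoodSeed_optimalVec⟩
  rw [← norm_sq_smul_sqrtAbsY]
  refine hO.isLUB_probDensity isSqrtOf_sqrtPiDivAbsY.1.1 sqrtPiDivAbsY_injective ?_
    (inner_eq_inner_sqrtPiDivAbsY ψ) g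
  have h0 : sqrtAbsY ψ ≠ 0 := fun h => by
    rw [sqrtAbsY_injective ψ h, norm_zero] at hψ
    exact zero_ne_one hψ
  have hpi := (Real.sqrt_pos.mpr Real.pi_pos).ne'
  exact smul_ne_zero (by exact_mod_cast inv_ne_zero hpi) h0
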